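/- Let $n\in\mathbb N$, let $\Theta\in M_n(\mathbb R)$ be skew-symmetric and let $(g^{\mu\nu})\in M_n(\mathbb R)$ be a constant symmetric positive definite matrix. Let $C^\infty(\mathbb T^n_\Theta)$ be the smooth noncommutative torus: its elements are the series $a=(2\pi)^{-n/2}\sum_{k\in\mathbb Z^n}a_kU_k$ with $(a_k)$ rapidly decreasing, where the unitaries $U_k$ satisfy $U_kU_q=e^{-\frac i2\sum_{i,j}k_i\Theta_{ij}q_j}U_{k+q}$ and $U_k^*=U_{-k}$. Let $\tau(a)=(2\pi)^{-n/2}a_0$ be its normalized trace and let $\mathcal H_\tau$ be the GNS Hilbert space, i.e. the completion for $\langle a,b\rangle=\tau(a^*b)$, in which $(U_k)_{k\in\mathbb Z^n}$ is an orthonormal basis. Let $L(a)$ and $R(a)$ be the bounded operators on $\mathcal H_\tau$ of left and right multiplication by $a$, and let $\delta_\mu$ be the unbounded operator $\delta_\mu U_k=ik_\mu U_k$ with its maximal domain $\{\sum_k x_kU_k\in\mathcal H_\tau : \sum_k k_\mu^2|x_k|^2<\infty\}$. For $\lambda_\mu,\rho_\mu,l_1,l_2,r_1,r_2\in C^\infty(\mathbb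 T^n_\Theta)$ ($1\le\mu\le n$) put $$\nabla_\mu=\delta_\mu+L(\lambda_\mu)-R(\rho_\mu),\qquad E=L(l_1)-R(r_1)+L(l_2)R(r_2),\qquad P=-\Big(\sum_{\mu,\nu}g^{\mu\nu}\nabla_\mu\nabla_\nu+E\Big),$$ where $P$ has its natural domain $\bigcap_{\mu,\nu}\{x\in\mathrm{dom}\,\nabla_\nu : \nabla_\nu x\in\mathrm{dom}\,\nabla_\mu\}$. Lemma. There is exactly one strongly continuous semigroup $(e^{-tP})_{t\ge0}$ of bounded operators on $\mathcal H_\tau$ whose infinitesimal generator is $-P$ (domains included), and $e^{-tP}$ is trace-class for every $t>0$, i.e. $\mathrm{Tr}\,|e^{-tP}|<\infty$. -/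

import Mathlib

open scoped NNReal Topology

noncomputable section

namespace NCTorus

/-- The bicharacter `e^{-(i/2) k.Θq}` on `ℤⁿ`. -/
def phase {n : ℕ} (Θ : Matrix (Fin n) (Fin n) ℝ) (k q : Fin n → ℤ) : ℂ :=
  Complex.exp (-(Complex.I / 2) * ((∑ i, ∑ j, (k i : ℝ) * Θ i j * (q j : ℝ) : ℝ) : ℂ))

/-- The normalization constant `(2π)^{-n/2}`. -/
def normConst (n : ℕ) : ℂ := (((2 * Real.pi) ^ (-(n : ℝ) / 2) : ℝ) : ℂ)

/-- The smooth noncommutative torus `C^∞(𝕋ⁿ_Θ)`: the element with coefficients `(a_k)` is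
`a = (2π)^{-n/2} ∑ₖ a_k U_k`, where `(a_k)` decays faster than any power of `k` and the `U_k` are
the Weyl unitaries, with `U_k U_q = e^{-(i/2) k.Θq} U_{k+q}` and `U_k^* = U_{-k}`. -/
@[ext]
structure SmoothTorus {n : ℕ} (Θ : Matrix (Fin n) (Fin n) ℝ) where
  coeff : (Fin n → ℤ) → ℂ
  decay : ∀ N : ℕ, ∃ C : ℝ, ∀ k : Fin n → ℤ, (1 + ‖k‖) ^ N * ‖coeff k‖ ≤ C

theorem norm_phase {n : ℕ} (Θ : Matrix (Fin n) (Fin n) ℝ) (k q : Fin n → ℤ) :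
    ‖phase Θ k q‖ = 1 := by
  unfold phase
  set r : ℝ := ∑ i, ∑ j, (k i : ℝ) * Θ i j * (q j : ℝ)
  have : -(Complex.I / 2) * (r : ℂ) = ((-(r / 2) : ℝ) : ℂ) * Complex.I := by
    push_cast; ring
  rw [this, Complex.norm_exp_ofReal_mul_I]

theorem normConst_ne_zero (n : ℕ) : normConst n ≠ 0 := by
  unfold normConst
  exact_mod_cast (Real.rpow_pos_of_pos (by positivity) _).ne'

/-- `∑ₖ (1 + |k|)^{-M}` converges over `ℤⁿ` for some `M`. -/
theorem exists_summable_weight (n : ℕ) :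
    ∃ M : ℕ, Summable fun k : Fin n → ℤ => ((1 + ‖k‖) ^ M : ℝ)⁻¹ := by
  let Λ : Submodule ℤ (Fin n → ℝ) := Submodule.span ℤ (Set.range (Pi.basisFun ℝ (Fin n)))
  let f : (Fin n → ℤ) → Λ := fun k => ⟨fun i => (k i : ℝ), by
    rw [(Pi.basisFun ℝ (Fin n)).mem_span_iff_repr_mem ℤ]
    intro i
    exact ⟨k i, by simp⟩⟩
  have hf : Function.Injective f := by
    intro k q h
    ext i
    have h1 : (k i : ℝ) = (q i : ℝ) := congrFun (congrArg Subtype.val h) i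
    exact_mod_cast h1
  have hn : ∀ k, ‖f k‖ = ‖k‖ := by
    intro k
    simp only [f, Submodule.coe_norm, Pi.norm_def]
    rfl
  have h := (ZLattice.summable_norm_pow_inv (L := Λ) _ (Nat.lt_succ_self _)).comp_injective hf
  refine ⟨(Module.finrank ℤ Λ).succ, Summable.of_norm_bounded_eventually h ?_⟩
  filter_upwards [(Set.finite_singleton (0 : Fin n → ℤ)).compl_mem_cofinite] with k hk
  have hk0 : 0 < ‖k‖ := norm_pos_iff.2 hk
  simp only [Function.comp, hn]
  rw [Real.norm_of_nonneg (by positivity)]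
  try rw [← inv_pow]
  try gcongr
  try linarith

theorem SmoothTorus.summable_weight {n : ℕ} {Θ : Matrix (Fin n) (Fin n) ℝ} (a : SmoothTorus Θ)
    (N : ℕ) : Summable fun k : Fin n → ℤ => (1 + ‖k‖) ^ N * ‖a.coeff k‖ := by
  obtain ⟨M, hM⟩ := exists_summable_weight n
  obtain ⟨C, hC⟩ := a.decay (N + M)
  refine Summable.of_nonneg_of_le (fun k => by positivity) (fun k => ?_) (hM.mul_left C)
  have h : (0 : ℝ) < (1 + ‖k‖) ^ M := by positivity
  rw [← div_eq_mul_inv, le_div_iff₀ h]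
  calc _ = (1 + ‖k‖) ^ (N + M) * ‖a.coeff k‖ := by ring
    _ ≤ C := hC k

theorem SmoothTorus.summable_norm {n : ℕ} {Θ : Matrix (Fin n) (Fin n) ℝ} (a : SmoothTorus Θ) :
    Summable fun k => ‖a.coeff k‖ := by
  simpa using a.summable_weight 0

theorem SmoothTorus.exists_bound {n : ℕ} {Θ : Matrix (Fin n) (Fin n) ℝ} (a : SmoothTorus Θ) :
    ∃ C : ℝ, ∀ k, ‖a.coeff k‖ ≤ C := by
  simpa using a.decay 0

theorem SmoothTorus.summable_conv {n : ℕ} {Θ : Matrix (Fin n) (Fin n) ℝ} (a b : SmoothTorus Θ)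
    (k : Fin n → ℤ) :
    Summable fun q => a.coeff q * b.coeff (k - q) * phase Θ q (k - q) := by
  obtain ⟨C, hC⟩ := b.exists_bound
  refine Summable.of_norm_bounded (a.summable_norm.mul_right C) fun q => ?_
  rw [norm_mul, norm_mul, norm_phase, mul_one]
  exact mul_le_mul_of_nonneg_left (hC _) (norm_nonneg _)

theorem SmoothTorus.decay_conv {n : ℕ} {Θ : Matrix (Fin n) (Fin n) ℝ} (a b : SmoothTorus Θ)
    (N : ℕ) : ∃ C : ℝ, ∀ k : Fin n → ℤ, (1 + ‖k‖) ^ N *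
      ‖normConst n * ∑' q, a.coeff q * b.coeff (k - q) * phase Θ q (k - q)‖ ≤ C := by
  obtain ⟨C, hC⟩ := b.decay N
  have hs := a.summable_weight N
  refine ⟨‖normConst n‖ * ((∑' q, (1 + ‖q‖) ^ N * ‖a.coeff q‖) * C), fun k => ?_⟩
  rw [norm_mul, mul_left_comm]
  refine mul_le_mul_of_nonneg_left ?_ (norm_nonneg _)
  have hterm : ∀ q, (1 + ‖k‖) ^ N * ‖a.coeff q * b.coeff (k - q) * phase Θ q (k - q)‖ ≤
      (1 + ‖q‖) ^ N * ‖a.coeff q‖ * C := by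
    intro q
    have h1 : 1 + ‖k‖ ≤ (1 + ‖q‖) * (1 + ‖k - q‖) := by
      have := norm_add_le q (k - q)
      rw [add_sub_cancel] at this
      nlinarith [norm_nonneg q, norm_nonneg (k - q), mul_nonneg (norm_nonneg q) (norm_nonneg (k - q))]
    have h2 : (1 + ‖k‖) ^ N ≤ (1 + ‖q‖) ^ N * (1 + ‖k - q‖) ^ N := by
      rw [← mul_pow]
      exact pow_le_pow_left₀ (by positivity) h1 N
    rw [norm_mul, norm_mul, norm_phase, mul_one]
    calc (1 + ‖k‖) ^ N * (‖a.coeff q‖ * ‖b.coeff (k - q)‖)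
        ≤ (1 + ‖q‖) ^ N * (1 + ‖k - q‖) ^ N * (‖a.coeff q‖ * ‖b.coeff (k - q)‖) := by gcongr
      _ = (1 + ‖q‖) ^ N * ‖a.coeff q‖ * ((1 + ‖k - q‖) ^ N * ‖b.coeff (k - q)‖) := by ring
      _ ≤ _ := mul_le_mul_of_nonneg_left (hC _) (by positivity)
  rw [← tsum_mul_right]
  calc _ ≤ (1 + ‖k‖) ^ N * ∑' q, ‖a.coeff q * b.coeff (k - q) * phase Θ q (k - q)‖ := by
        gcongr
        exact norm_tsum_le_tsum_norm (a.summable_conv b k).norm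
    _ = ∑' q, (1 + ‖k‖) ^ N * ‖a.coeff q * b.coeff (k - q) * phase Θ q (k - q)‖ := by
        rw [tsum_mul_left]
    _ ≤ _ := Summable.tsum_le_tsum hterm ((a.summable_conv b k).norm.mul_left _)
        (hs.mul_right C)

instance {n : ℕ} (Θ : Matrix (Fin n) (Fin n) ℝ) : Mul (SmoothTorus Θ) where
  mul a b :=
    { coeff := fun k => normConst n * ∑' q, a.coeff q * b.coeff (k - q) * phase Θ q (k - q)
      decay := a.decay_conv b }

instance {n : ℕ} (Θ : Matrix (Fin n) (Fin n) ℝ) : Star (SmoothTorus Θ) where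
  star a :=
    { coeff := fun k => (starRingEnd ℂ) (a.coeff (-k))
      decay := fun N => by
        obtain ⟨C, hC⟩ := a.decay N
        exact ⟨C, fun k => by simpa using hC (-k)⟩ }

/-- The normalized trace `τ(a) = (2π)^{-n/2} a_0`. -/
def trace {n : ℕ} {Θ : Matrix (Fin n) (Fin n) ℝ} (a : SmoothTorus Θ) : ℂ :=
  normConst n * a.coeff 0

/-- The GNS Hilbert space `H_τ` of the trace `τ`, written in its orthonormal basis `(U_k)`:
the vector `x` stands for `∑ₖ x_k U_k`. The embedding of the smooth torus is `toGNS`. -/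
abbrev GNS (n : ℕ) : Type := lp (fun _ : Fin n → ℤ => ℂ) 2

theorem SmoothTorus.memℓp {n : ℕ} {Θ : Matrix (Fin n) (Fin n) ℝ} (a : SmoothTorus Θ) :
    Memℓp (fun k => normConst n * a.coeff k) 2 := by
  refine Memℓp.const_mul ?_ _
  have h : Memℓp a.coeff 1 := memℓp_gen (by simpa using a.summable_norm)
  exact h.of_exponent_ge (by norm_num)

/-- The inclusion of the smooth torus into its GNS space. -/
def toGNS {n : ℕ} {Θ : Matrix (Fin n) (Fin n) ℝ} (a : SmoothTorus Θ) : GNS n :=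
  ⟨fun k => normConst n * a.coeff k, a.memℓp⟩

theorem memℓp_shift {n : ℕ} (k : Fin n → ℤ) (c : (Fin n → ℤ) → ℂ) (hc : ∀ m, ‖c m‖ = 1)
    (x : GNS n) : Memℓp (fun m => c (m - k) * x (m - k)) 2 := by
  have h := (lp.memℓp x).summable (by norm_num)
  refine memℓp_gen ?_
  simp only [norm_mul, hc, one_mul]
  exact h.comp_injective (sub_left_injective (b := k))

/-- The operator `∑ₘ x_m U_m ↦ ∑ₘ c_m x_m U_{m+k}` for unimodular `c`. -/
def weightedShift {n : ℕ} (k : Fin n → ℤ) (c : (Fin n → ℤ) → ℂ) (hc : ∀ m, ‖c m‖ = 1) :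
    GNS n →ₗᵢ[ℂ] GNS n where
  toFun x := ⟨fun m => c (m - k) * x (m - k), memℓp_shift k c hc x⟩
  map_add' x y := by
    ext m; exact mul_add _ _ _
  map_smul' r x := by
    ext m; exact mul_left_comm _ _ _
  norm_map' x := by
    have h2 : (0 : ℝ) < (2 : ENNReal).toReal := by norm_num
    rw [lp.norm_eq_tsum_rpow h2, lp.norm_eq_tsum_rpow h2]
    congr 1
    simp only [LinearMap.coe_mk, AddHom.coe_mk, norm_mul, hc, one_mul]
    exact (Equiv.subRight k).tsum_eq fun m => ‖x m‖ ^ (2 : ENNReal).toReal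

/-- Multiplication by `U_k` from the left: `U_m ↦ U_k U_m`. -/
def leftWeyl {n : ℕ} (Θ : Matrix (Fin n) (Fin n) ℝ) (k : Fin n → ℤ) : GNS n →L[ℂ] GNS n :=
  (weightedShift k (fun m => phase Θ k m) fun _ => norm_phase Θ _ _).toContinuousLinearMap

/-- Multiplication by `U_k` from the right: `U_m ↦ U_m U_k`. -/
def rightWeyl {n : ℕ} (Θ : Matrix (Fin n) (Fin n) ℝ) (k : Fin n → ℤ) : GNS n →L[ℂ] GNS n :=
  (weightedShift k (fun m => phase Θ m k) fun _ => norm_phase Θ _ _).toContinuousLinearMap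

/-- The left regular representation `L(a)`, a norm convergent series. -/
def L {n : ℕ} {Θ : Matrix (Fin n) (Fin n) ℝ} (a : SmoothTorus Θ) : GNS n →L[ℂ] GNS n :=
  normConst n • ∑' k, a.coeff k • leftWeyl Θ k

/-- The right regular representation `R(a)`, a norm convergent series. -/
def R {n : ℕ} {Θ : Matrix (Fin n) (Fin n) ℝ} (a : SmoothTorus Θ) : GNS n →L[ℂ] GNS n :=
  normConst n • ∑' k, a.coeff k • rightWeyl Θ k

theorem norm_leftWeyl_le {n : ℕ} (Θ : Matrix (Fin n) (Fin n) ℝ) (k : Fin n → ℤ) :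
    ‖leftWeyl Θ k‖ ≤ 1 := LinearIsometry.norm_toContinuousLinearMap_le _

theorem norm_rightWeyl_le {n : ℕ} (Θ : Matrix (Fin n) (Fin n) ℝ) (k : Fin n → ℤ) :
    ‖rightWeyl Θ k‖ ≤ 1 := LinearIsometry.norm_toContinuousLinearMap_le _

theorem SmoothTorus.summable_smul {n : ℕ} {Θ : Matrix (Fin n) (Fin n) ℝ} (a : SmoothTorus Θ)
    (W : (Fin n → ℤ) → GNS n →L[ℂ] GNS n) (hW : ∀ k, ‖W k‖ ≤ 1) :
    Summable fun k => a.coeff k • W k := by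
  refine Summable.of_norm_bounded a.summable_norm fun k => ?_
  rw [norm_smul]
  exact mul_le_of_le_one_right (norm_nonneg _) (hW k)

theorem L_apply {n : ℕ} {Θ : Matrix (Fin n) (Fin n) ℝ} (a : SmoothTorus Θ) (x : GNS n)
    (m : Fin n → ℤ) :
    L a x m = normConst n * ∑' k, a.coeff k * (phase Θ k (m - k) * x (m - k)) := by
  have h := a.summable_smul (leftWeyl Θ) (norm_leftWeyl_le Θ)
  have h' := ((lp.evalCLM ℂ (fun _ : Fin n → ℤ => ℂ) 2 m).comp
    (ContinuousLinearMap.apply ℂ (GNS n) x)).map_tsum h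
  change normConst n * ((lp.evalCLM ℂ (fun _ : Fin n → ℤ => ℂ) 2 m).comp
    (ContinuousLinearMap.apply ℂ (GNS n) x)) (∑' k, a.coeff k • leftWeyl Θ k) = _
  rw [h']
  rfl

theorem R_apply {n : ℕ} {Θ : Matrix (Fin n) (Fin n) ℝ} (a : SmoothTorus Θ) (x : GNS n)
    (m : Fin n → ℤ) :
    R a x m = normConst n * ∑' k, a.coeff k * (phase Θ (m - k) k * x (m - k)) := by
  have h := a.summable_smul (rightWeyl Θ) (norm_rightWeyl_le Θ)
  have h' := ((lp.evalCLM ℂ (fun _ : Fin n → ℤ => ℂ) 2 m).comp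
    (ContinuousLinearMap.apply ℂ (GNS n) x)).map_tsum h
  change normConst n * ((lp.evalCLM ℂ (fun _ : Fin n → ℤ => ℂ) 2 m).comp
    (ContinuousLinearMap.apply ℂ (GNS n) x)) (∑' k, a.coeff k • rightWeyl Θ k) = _
  rw [h']
  rfl

theorem phase_neg_self {n : ℕ} {Θ : Matrix (Fin n) (Fin n) ℝ} (hΘ : Θ.transpose = -Θ)
    (q : Fin n → ℤ) : phase Θ q (-q) = 1 := by
  have h : (∑ i, ∑ j, (q i : ℝ) * Θ i j * (((-q) j : ℤ) : ℝ)) = 0 := by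
    have h1 : (∑ i, ∑ j, (q i : ℝ) * Θ i j * (((-q) j : ℤ) : ℝ)) =
        -(∑ i, ∑ j, (q i : ℝ) * Θ i j * (((-q) j : ℤ) : ℝ)) := by
      conv_lhs => rw [Finset.sum_comm]
      rw [← Finset.sum_neg_distrib]
      refine Finset.sum_congr rfl fun i _ => ?_
      rw [← Finset.sum_neg_distrib]
      refine Finset.sum_congr rfl fun j _ => ?_
      have : Θ j i = -Θ i j := congrFun (congrFun hΘ i) j
      rw [this]
      simp only [Pi.neg_apply]
      push_cast
      ring
    linarith
  rw [phase, h]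
  simp

/-- The inner product of `H_τ` is `⟨a, b⟩ = τ(a^* b)` on the smooth torus. -/
theorem inner_toGNS {n : ℕ} {Θ : Matrix (Fin n) (Fin n) ℝ} (hΘ : Θ.transpose = -Θ)
    (a b : SmoothTorus Θ) : inner ℂ (toGNS a) (toGNS b) = trace (star a * b) := by
  have hc : (starRingEnd ℂ) (normConst n) = normConst n := Complex.conj_ofReal _
  change _ = normConst n * (normConst n * ∑' q, (starRingEnd ℂ) (a.coeff (-q)) *
    b.coeff (0 - q) * phase Θ q (0 - q))
  rw [lp.inner_eq_tsum, ← tsum_mul_left, ← tsum_mul_left, ← (Equiv.neg (Fin n → ℤ)).tsum_eq]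
  refine tsum_congr fun q => ?_
  rw [zero_sub, phase_neg_self hΘ]
  simp only [toGNS, RCLike.inner_apply, map_mul, hc, Equiv.neg_apply]
  ring

/-- The smooth torus is dense in `H_τ`. -/
theorem denseRange_toGNS {n : ℕ} (Θ : Matrix (Fin n) (Fin n) ℝ) :
    DenseRange (toGNS : SmoothTorus Θ → GNS n) := by
  intro x
  refine mem_closure_of_tendsto (lp.hasSum_single (by norm_num) x)
    (Filter.Eventually.of_forall fun s => ?_)
  refine ⟨⟨fun k => (normConst n)⁻¹ * (∑ i ∈ s, lp.single 2 i (x i) : GNS n) k, fun N => ?_⟩, ?_⟩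
  · refine ⟨∑ i ∈ s, (1 + ‖i‖) ^ N * ‖(normConst n)⁻¹ * x i‖, fun k => ?_⟩
    rw [lp.coeFn_sum, Finset.sum_apply]
    by_cases hk : k ∈ s
    · rw [Finset.sum_eq_single_of_mem k hk
        (fun i _ hi => lp.single_apply_ne _ _ _ hi.symm), lp.single_apply_self]
      exact Finset.single_le_sum (f := fun i : Fin n → ℤ =>
        (1 + ‖i‖) ^ N * ‖(normConst n)⁻¹ * x i‖) (fun i _ => by positivity) hk
    · rw [Finset.sum_eq_zero
        (fun i hi => lp.single_apply_ne _ _ _ (fun h : k = i => hk (h ▸ hi))), mul_zero, norm_zero, mul_zero]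
      exact Finset.sum_nonneg fun i _ => by positivity
  · ext k
    exact mul_inv_cancel_left₀ (normConst_ne_zero n) _

/-- `L(a)` is left multiplication by `a`. -/
theorem L_toGNS {n : ℕ} {Θ : Matrix (Fin n) (Fin n) ℝ} (a b : SmoothTorus Θ) :
    L a (toGNS b) = toGNS (a * b) := by
  ext m
  rw [L_apply]
  change _ = normConst n * (normConst n * ∑' q, a.coeff q * b.coeff (m - q) * phase Θ q (m - q))
  rw [← tsum_mul_left (a := normConst n) (f := fun q => a.coeff q * b.coeff (m - q) * _)]
  congr 1
  refine tsum_congr fun q => ?_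
  change a.coeff q * (phase Θ q (m - q) * (normConst n * b.coeff (m - q))) = _
  ring

/-- `R(b)` is right multiplication by `b`. -/
theorem R_toGNS {n : ℕ} {Θ : Matrix (Fin n) (Fin n) ℝ} (a b : SmoothTorus Θ) :
    R b (toGNS a) = toGNS (a * b) := by
  ext m
  rw [R_apply]
  change _ = normConst n * (normConst n * ∑' q, a.coeff q * b.coeff (m - q) * phase Θ q (m - q))
  rw [← tsum_mul_left (a := normConst n) (f := fun q => a.coeff q * b.coeff (m - q) * _),
    ← (Equiv.subLeft m).tsum_eq]
  congr 1
  refine tsum_congr fun q => ?_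
  change b.coeff (m - q) * (phase Θ (m - (m - q)) (m - q) *
    (normConst n * a.coeff (m - (m - q)))) = _
  rw [sub_sub_cancel]
  ring

/-- The unbounded operator `δ_μ` on `H_τ`, `δ_μ U_k = i k_μ U_k`, with its maximal domain. -/
def deriv {n : ℕ} (μ : Fin n) : GNS n →ₗ.[ℂ] GNS n where
  domain :=
    { carrier := {x | Memℓp (fun k : Fin n → ℤ => Complex.I * (k μ : ℂ) * x k) 2}
      zero_mem' := by
        change Memℓp _ 2
        convert zero_mem_ℓp' (E := fun _ : Fin n → ℤ => ℂ) using 1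
        ext k; exact mul_zero _
      add_mem' := fun {x y} hx hy => by
        have := Memℓp.add hx hy
        change Memℓp _ 2
        convert this using 1
        ext k; exact mul_add _ _ _
      smul_mem' := fun c x hx => by
        have h : (fun k : Fin n → ℤ => Complex.I * (k μ : ℂ) * (c • x) k) =
            fun k => c * (Complex.I * (k μ : ℂ) * x k) :=
          funext fun k => mul_left_comm (Complex.I * (k μ : ℂ)) c (x k)
        change Memℓp (fun k : Fin n → ℤ => Complex.I * (k μ : ℂ) * (c • x) k) 2
        rw [h]
        exact Memℓp.const_mul hx c }
  toFun :=
    { toFun := fun x => ⟨fun k => Complex.I * (k μ : ℂ) * (x : GNS n) k, x.2⟩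
      map_add' := fun x y => by ext k; exact mul_add _ _ _
      map_smul' := fun c x => by ext k; exact mul_left_comm _ _ _ }

theorem mem_domain_of_comp {E : Type*} [AddCommGroup E] [Module ℂ E] {S T : E →ₗ.[ℂ] E} {x : E}
    (hx : x ∈ (S.domain.comap T.toFun).map T.domain.subtype) : x ∈ T.domain := by
  obtain ⟨y, -, rfl⟩ := hx
  exact y.2

theorem apply_mem_of_comp {E : Type*} [AddCommGroup E] [Module ℂ E] {S T : E →ₗ.[ℂ] E} {x : E}
    (hx : x ∈ (S.domain.comap T.toFun).map T.domain.subtype) :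
    T ⟨x, mem_domain_of_comp hx⟩ ∈ S.domain := by
  obtain ⟨y, hy, rfl⟩ := hx
  exact hy

/-- The product `S T` of unbounded operators, with its natural domain
`{x ∈ dom T | T x ∈ dom S}`. -/
def pmapComp {E : Type*} [AddCommGroup E] [Module ℂ E] (S T : E →ₗ.[ℂ] E) : E →ₗ.[ℂ] E where
  domain := (S.domain.comap T.toFun).map T.domain.subtype
  toFun :=
    { toFun := fun x => S ⟨T ⟨x, mem_domain_of_comp x.2⟩, apply_mem_of_comp x.2⟩
      map_add' := fun x y => by
        rw [← S.map_add]
        congr 1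
        ext1
        exact T.map_add ⟨x, mem_domain_of_comp x.2⟩ ⟨y, mem_domain_of_comp y.2⟩
      map_smul' := fun c x => by
        rw [RingHom.id_apply, ← S.map_smul]
        congr 1
        ext1
        exact T.map_smul c ⟨x, mem_domain_of_comp x.2⟩ }

/-- A bounded operator, as an everywhere defined operator. -/
def ofBounded {n : ℕ} (A : GNS n →L[ℂ] GNS n) : GNS n →ₗ.[ℂ] GNS n :=
  LinearMap.toPMap (A : GNS n →ₗ[ℂ] GNS n) ⊤

/-- The covariant derivative `∇_μ = δ_μ + L(λ_μ) - R(ρ_μ)`. -/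
def nabla {n : ℕ} {Θ : Matrix (Fin n) (Fin n) ℝ} (lam rho : Fin n → SmoothTorus Θ) (μ : Fin n) :
    GNS n →ₗ.[ℂ] GNS n :=
  deriv μ + ofBounded (L (lam μ) - R (rho μ))

/-- The potential `E = L(l₁) - R(r₁) + L(l₂) R(r₂)`. -/
def potential {n : ℕ} {Θ : Matrix (Fin n) (Fin n) ℝ} (l₁ r₁ l₂ r₂ : SmoothTorus Θ) :
    GNS n →L[ℂ] GNS n :=
  L l₁ - R r₁ + L l₂ * R r₂

/-- The generalized Laplacian `P = -(g^{μν} ∇_μ ∇_ν + E)`, with its natural domain;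
`g` is the matrix `(g^{μν})`. -/
def genLaplacian {n : ℕ} {Θ : Matrix (Fin n) (Fin n) ℝ} (g : Matrix (Fin n) (Fin n) ℝ)
    (lam rho : Fin n → SmoothTorus Θ) (l₁ r₁ l₂ r₂ : SmoothTorus Θ) : GNS n →ₗ.[ℂ] GNS n :=
  -((∑ μ, ∑ ν, (g μ ν : ℂ) • pmapComp (nabla lam rho μ) (nabla lam rho ν)) +
    ofBounded (potential l₁ r₁ l₂ r₂))

/-- `T` is the strongly continuous semigroup `t ↦ e^{-tP}`: it is a `C₀`-semigroup and its
infinitesimal generator (as an unbounded operator, domain included) is `-P`. -/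
structure IsExpNegSemigroup {E : Type*} [NormedAddCommGroup E] [NormedSpace ℂ E]
    (P : E →ₗ.[ℂ] E) (T : ℝ≥0 → E →L[ℂ] E) : Prop where
  map_zero : T 0 = 1
  map_add : ∀ s t, T (s + t) = T s * T t
  continuous : ∀ x, Continuous fun t => T t x
  generator : ∀ x y, (x, y) ∈ (-P).graph ↔
    Filter.Tendsto (fun h : ℝ≥0 => (((h : ℝ) : ℂ))⁻¹ • (T h x - x)) (𝓝[>] 0) (𝓝 y)

/-- `A` is trace-class: `Tr |A| = ∑ᵢ ⟨eᵢ, |A| eᵢ⟩ < ∞` for every Hilbert basis `(eᵢ)`,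
where `|A| = (A^* A)^{1/2}`. -/
def IsTraceClass.{u} {E : Type u} [NormedAddCommGroup E] [InnerProductSpace ℂ E] [CompleteSpace E]
    (A : E →L[ℂ] E) : Prop :=
  ∀ (ι : Type u) (e : HilbertBasis ι ℂ E),
    Summable fun i => (inner ℂ (e i) (CFC.abs A (e i))).re

end NCTorus

end

/-!
In the orthonormal basis `(U_k)` the operator `-P` has the normal form
`∑ g^{μν} δ_μ δ_ν + ∑ C_μ δ_μ + D` with bounded `C_μ` and `D`, by the Leibniz rule for `δ_μ` and the
multiplications `L(a)`, `R(a)`; its natural domain is the second Sobolev space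
(`mem_graph_neg_genLaplacian_iff`). The principal part is the Fourier multiplier `-q(k)`, where
`q(k) = ∑ g^{μν} k_μ k_ν` is bounded below by a multiple of `|k|²`.

*Generation.* Since `‖δ_μ x‖² ≤ c⁻¹ ⟨x, q x⟩`, the first order part is absorbed in Gårding's
inequality `Re ⟨x, P x⟩ ≥ -ω ‖x‖²` (`exists_genLaplacian_lower_bound`). For large `r` the multiplier
`(r + q)⁻¹` inverts `r + P` up to an operator of norm less than one, so `r + P` is onto
(`exists_genLaplacian_surjective`). The Lumer–Phillips theorem, obtained here from Yosida
approximations, gives the semigroup (`exists_isExpNegSemigroup`). Gårding's inequality also bounds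
the growth of the difference of two orbits with the same initial value, hence uniqueness
(`IsExpNegSemigroup.unique`).

*Trace class.* An operator `A` with `∑ₖ ‖A U_k‖ < ∞` is trace-class
(`isTraceClass_of_summable_norm`), so it suffices that `‖e^{-tP} U_k‖` decays faster than any power
of `k`. Writing `-P U_k = -(q(k) + 1) U_k + y_k`, where `y_k` comes from the lower order part, the
derivative of `s ↦ e^{-(t-s)(q(k)+1)} e^{-sP} U_k` is `e^{-(t-s)(q(k)+1)} e^{-sP} y_k`. Integrated
over `[t₀, t]` this bounds `‖e^{-tP} U_k‖` by an exponentially small term plus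
`(q(k) + 1)⁻¹ sup ‖e^{-sP} y_k‖` (`IsExpNegSemigroup.norm_apply_le`). Multiplication by smooth
elements preserves polynomial decay (`IsTame`) and `y_k` costs only one factor `1 + |k|`, so an
estimate of order `(1 + |k|)^{-a}` improves to order `(1 + |k|)^{-a-1}`; one iterates from the
boundedness of `e^{-sP}` (`IsExpNegSemigroup.exists_norm_apply_weyl_le`).
-/

noncomputable section

namespace NCTorus

/-! ### Dissipative operators and Yosida approximation -/

section Dissipative

variable {E : Type*} [NormedAddCommGroup E] [InnerProductSpace ℂ E]

theorem hasDerivAt_exp_smul_apply [CompleteSpace E] (X : E →L[ℂ] E) (x : E) (t : ℝ) :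
    HasDerivAt (fun s : ℝ => NormedSpace.exp (s • X) x) (NormedSpace.exp (t • X) (X x)) t := by
  have h := hasDerivAt_exp_smul_const (𝕂 := ℝ) X t
  have h2 := ((ContinuousLinearMap.apply ℂ E x).restrictScalars ℝ).hasFDerivAt.comp_hasDerivAt t h
  exact h2

/-- A dissipative bounded operator generates contractions: `d/dt ‖e^{tX} x‖² ≤ 0`. -/
theorem norm_exp_smul_apply_le [CompleteSpace E] {X : E →L[ℂ] E}
    (hX : ∀ x, (inner ℂ x (X x)).re ≤ 0) {t : ℝ} (ht : 0 ≤ t) (x : E) :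
    ‖NormedSpace.exp (t • X) x‖ ≤ ‖x‖ := by
  have hd : ∀ s : ℝ, HasDerivAt (fun s : ℝ => ‖NormedSpace.exp (s • X) x‖ ^ 2)
      (2 * (inner ℂ (NormedSpace.exp (s • X) x) (X (NormedSpace.exp (s • X) x))).re) s := by
    intro s
    have h := hasDerivAt_exp_smul_apply X x s
    have hc : NormedSpace.exp (s • X) (X x) = X (NormedSpace.exp (s • X) x) := by
      have : Commute (NormedSpace.exp (s • X)) X :=
        ((Commute.refl X).smul_left s).exp_left
      exact congrArg (fun Z : E →L[ℂ] E => Z x) this.eq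
    rw [hc] at h
    let _ : InnerProductSpace ℝ E := InnerProductSpace.complexToReal
    exact h.norm_sq
  have hanti : Antitone (fun s : ℝ => ‖NormedSpace.exp (s • X) x‖ ^ 2) := by
    refine antitone_of_deriv_nonpos (fun s => (hd s).differentiableAt) fun s => ?_
    rw [(hd s).deriv]
    have := hX (NormedSpace.exp (s • X) x)
    linarith
  have h := hanti ht
  simp only [zero_smul, NormedSpace.exp_zero, one_apply_eq_self] at h
  exact le_of_sq_le_sq h (norm_nonneg _)

/-- Along the segment from `t Y` to `t X`, the exponential changes at rate `X - Y` times a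
contraction. -/
theorem norm_exp_smul_sub_exp_smul_le [CompleteSpace E] {X Y : E →L[ℂ] E}
    (hX : ∀ x, (inner ℂ x (X x)).re ≤ 0) (hY : ∀ x, (inner ℂ x (Y x)).re ≤ 0)
    (hXY : Commute X Y) {t : ℝ} (ht : 0 ≤ t) (x : E) :
    ‖NormedSpace.exp (t • X) x - NormedSpace.exp (t • Y) x‖ ≤ t * ‖X x - Y x‖ := by
  have hd : ∀ s ∈ Set.Icc (0 : ℝ) t,
      HasDerivWithinAt (fun s : ℝ => NormedSpace.exp (t • Y) (NormedSpace.exp (s • (X - Y)) x))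
        (NormedSpace.exp (t • Y) (NormedSpace.exp (s • (X - Y)) ((X - Y) x))) (Set.Icc 0 t) s := by
    intro s _
    have h := hasDerivAt_exp_smul_apply (X - Y) x s
    exact (((NormedSpace.exp (t • Y)).restrictScalars ℝ).hasFDerivAt.comp_hasDerivAt s
      h).hasDerivWithinAt
  have hsplit : ∀ s : ℝ, NormedSpace.exp (t • Y) * NormedSpace.exp (s • (X - Y)) =
      NormedSpace.exp ((t - s) • Y) * NormedSpace.exp (s • X) := by
    intro s
    have hc1 : Commute (t • Y) (s • (X - Y)) :=
      ((hXY.symm.sub_right (Commute.refl Y)).smul_left t).smul_right s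
    have hc2 : Commute ((t - s) • Y) (s • X) := (hXY.symm.smul_left _).smul_right _
    let _ : NormedAlgebra ℚ (E →L[ℂ] E) := NormedAlgebra.restrictScalars ℚ ℝ (E →L[ℂ] E)
    rw [← NormedSpace.exp_add_of_commute hc1, ← NormedSpace.exp_add_of_commute hc2]
    congr 1
    module
  have hb : ∀ s ∈ Set.Ico (0 : ℝ) t,
      ‖NormedSpace.exp (t • Y) (NormedSpace.exp (s • (X - Y)) ((X - Y) x))‖ ≤ ‖X x - Y x‖ := by
    intro s hs
    have h1 := congrArg (fun Z : E →L[ℂ] E => Z ((X - Y) x)) (hsplit s)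
    simp only [mul_apply_eq_comp] at h1
    rw [h1]
    exact (norm_exp_smul_apply_le hY (by linarith [hs.2]) _).trans
      (norm_exp_smul_apply_le hX hs.1 _)
  have := norm_image_sub_le_of_norm_deriv_le_segment' hd hb t ⟨ht, le_rfl⟩
  have h1 := congrArg (fun Z : E →L[ℂ] E => Z x) (hsplit t)
  simp only [mul_apply_eq_comp, sub_self, zero_smul, NormedSpace.exp_zero,
    one_apply_eq_self] at h1
  simp only [h1, zero_smul, NormedSpace.exp_zero, one_apply_eq_self, sub_zero] at this
  linarith

theorem norm_exp_smul_sub_self_le [CompleteSpace E] {X : E →L[ℂ] E}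
    (hX : ∀ x, (inner ℂ x (X x)).re ≤ 0) {t : ℝ} (ht : 0 ≤ t) (x : E) :
    ‖NormedSpace.exp (t • X) x - x‖ ≤ t * ‖X x‖ := by
  simpa using norm_exp_smul_sub_exp_smul_le hX (Y := 0) (by simp) (Commute.zero_right X) ht x

/-- A first order Taylor estimate whose remainder involves `X` only at an auxiliary vector `z`;
it survives the passage from bounded approximations to an unbounded generator. -/
theorem norm_exp_smul_sub_taylor_le [CompleteSpace E] {X : E →L[ℂ] E}
    (hX : ∀ x, (inner ℂ x (X x)).re ≤ 0) {t : ℝ} (ht : 0 ≤ t) (x z : E) :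
    ‖NormedSpace.exp (t • X) x - x - t • X x‖ ≤ (2 * ‖X x - z‖ + t * ‖X z‖) * t := by
  have hd : ∀ s ∈ Set.Icc (0 : ℝ) t,
      HasDerivWithinAt (fun s : ℝ => NormedSpace.exp (s • X) x - s • X x)
        (NormedSpace.exp (s • X) (X x) - (1 : ℝ) • X x) (Set.Icc 0 t) s := by
    intro s _
    exact ((hasDerivAt_exp_smul_apply X x s).sub
      ((hasDerivAt_id s).smul_const (X x))).hasDerivWithinAt
  have hb : ∀ s ∈ Set.Ico (0 : ℝ) t,
      ‖NormedSpace.exp (s • X) (X x) - (1 : ℝ) • X x‖ ≤ 2 * ‖X x - z‖ + t * ‖X z‖ := by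
    intro s hs
    have e : NormedSpace.exp (s • X) (X x) - (1 : ℝ) • X x =
        NormedSpace.exp (s • X) (X x - z) - (X x - z) + (NormedSpace.exp (s • X) z - z) := by
      rw [map_sub, one_smul]; abel
    rw [e]
    have h1 := norm_exp_smul_apply_le hX hs.1 (X x - z)
    have h2 := norm_exp_smul_sub_self_le hX hs.1 z
    have h3 : s * ‖X z‖ ≤ t * ‖X z‖ := mul_le_mul_of_nonneg_right hs.2.le (norm_nonneg _)
    have h4 := norm_add_le (NormedSpace.exp (s • X) (X x - z) - (X x - z))
      (NormedSpace.exp (s • X) z - z)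
    have h5 := norm_sub_le (NormedSpace.exp (s • X) (X x - z)) (X x - z)
    linarith
  have := norm_image_sub_le_of_norm_deriv_le_segment' hd hb t ⟨ht, le_rfl⟩
  simp only [zero_smul, NormedSpace.exp_zero, one_apply_eq_self, sub_zero] at this
  rwa [sub_right_comm]

/-- The resolvent `(c - A)⁻¹` of a dissipative operator with full range of `c - A`. -/
theorem exists_resolvent {D : Submodule ℂ E} {A : D →ₗ[ℂ] E}
    (hA : ∀ x : D, (inner ℂ (x : E) (A x)).re ≤ 0) {c : ℝ} (hc : 0 < c)
    (hr : ∀ y, ∃ x : D, (c : ℂ) • (x : E) - A x = y) :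
    ∃ J : E →L[ℂ] E, (∀ y, ∃ h : J y ∈ D, (c : ℂ) • J y - A ⟨J y, h⟩ = y) ∧
      (∀ x : D, J ((c : ℂ) • (x : E) - A x) = x) ∧ ∀ y, c * ‖J y‖ ≤ ‖y‖ := by
  have hlow : ∀ x : D, c * ‖(x : E)‖ ≤ ‖(c : ℂ) • (x : E) - A x‖ := by
    intro x
    have h1 : c * ‖(x : E)‖ ^ 2 ≤ (inner ℂ (x : E) ((c : ℂ) • (x : E) - A x)).re := by
      rw [inner_sub_right, inner_smul_right, Complex.sub_re, inner_self_eq_norm_sq_to_K]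
      have := hA x
      have e : ((c : ℂ) * ((‖(x : E)‖ : ℂ)) ^ 2).re = c * ‖(x : E)‖ ^ 2 := by
        rw [← Complex.ofReal_pow, ← Complex.ofReal_mul, Complex.ofReal_re]
      simp only [Complex.coe_algebraMap] at *
      rw [e]; linarith
    have h2 := (Complex.re_le_norm _).trans (norm_inner_le_norm (𝕜 := ℂ) (x : E)
      ((c : ℂ) • (x : E) - A x))
    rcases (norm_nonneg (x : E)).eq_or_lt with h0 | h0
    · rw [← h0]; simp
    · refine le_of_mul_le_mul_left ?_ h0
      nlinarith
  let B : D →ₗ[ℂ] E := (c : ℂ) • D.subtype - A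
  have hBx : ∀ x, B x = (c : ℂ) • (x : E) - A x := fun x => rfl
  have hbij : Function.Bijective B := by
    refine ⟨(injective_iff_map_eq_zero B).2 fun x hx => ?_, fun y => hr y⟩
    have := hlow x
    rw [← hBx, hx, norm_zero] at this
    have h0 : ‖(x : E)‖ = 0 := by nlinarith [norm_nonneg (x : E)]
    exact Subtype.ext (norm_eq_zero.1 h0)
  let e := LinearEquiv.ofBijective B hbij
  have he : ∀ y, (c : ℂ) • ((e.symm y : D) : E) - A (e.symm y) = y := fun y =>
    e.apply_symm_apply y
  have hb : ∀ y, c * ‖((e.symm y : D) : E)‖ ≤ ‖y‖ := fun y => by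
    have := hlow (e.symm y)
    rwa [he] at this
  refine ⟨(D.subtype ∘ₗ e.symm.toLinearMap).mkContinuous c⁻¹ fun y => ?_,
    fun y => ⟨(e.symm y).2, he y⟩, fun x => ?_, hb⟩
  · rw [inv_mul_eq_div, le_div_iff₀' hc]
    exact hb y
  · exact congrArg Subtype.val (e.symm_apply_apply x)

/-- The Yosida approximations `cₙ² (cₙ - A)⁻¹ - cₙ = cₙ A (cₙ - A)⁻¹`, with `cₙ → ∞`: commuting,
bounded and dissipative, dominated by `A` and converging to `A` on its domain. -/
theorem exists_yosida {D : Submodule ℂ E} (hD : Dense (D : Set E)) {A : D →ₗ[ℂ] E}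
    (hA : ∀ x : D, (inner ℂ (x : E) (A x)).re ≤ 0) {c₀ : ℝ}
    (hr : ∀ c ≥ c₀, ∀ y, ∃ x : D, (c : ℂ) • (x : E) - A x = y) :
    ∃ Y : ℕ → E →L[ℂ] E, (∀ m x, (inner ℂ x (Y m x)).re ≤ 0) ∧ (∀ k m, Commute (Y k) (Y m)) ∧
      (∀ m (x : D), ‖Y m x‖ ≤ ‖A x‖) ∧
      ∀ x : D, Filter.Tendsto (fun m => Y m x) Filter.atTop (𝓝 (A x)) := by
  let c : ℕ → ℝ := fun m => |c₀| + 1 + m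
  have hc : ∀ m, 0 < c m := fun m => by positivity
  have hc₀ : ∀ m, c₀ ≤ c m := fun m => by
    have := le_abs_self c₀
    have : (0 : ℝ) ≤ m := m.cast_nonneg
    simp only [c]; linarith
  have hctop : Filter.Tendsto c Filter.atTop Filter.atTop :=
    Filter.tendsto_atTop_add_const_left _ _ tendsto_natCast_atTop_atTop
  choose J hJ hJl hJb using fun m => exists_resolvent hA (hc m) (hr (c m) (hc₀ m))
  have hJA : ∀ m (x : D), J m (A x) = (c m : ℂ) • J m x - x := by
    intro m x
    have := hJl m x
    rw [map_sub, map_smul] at this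
    exact (sub_eq_of_eq_add (sub_eq_iff_eq_add'.1 this)).symm
  have hcomm : ∀ k m, Commute (J k) (J m) := by
    intro k m
    ext y
    simp only [mul_apply_eq_comp]
    obtain ⟨hv, hv'⟩ := hJ m y
    obtain ⟨hw, hw'⟩ := hJ k (J m y)
    have h1 : J k y = ((c m : ℂ) - c k) • J k (J m y) + J m y := by
      have h2 := congrArg (J k) hv'
      rw [map_sub, map_smul, hJA k ⟨_, hv⟩] at h2
      rw [← h2]; simp only [sub_smul]; abel
    have h3 := hJl m ⟨_, hw⟩
    have h4 : A ⟨_, hw⟩ = (c k : ℂ) • J k (J m y) - J m y := by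
      nth_rw 3 [← hw']; abel
    rw [h4] at h3
    simp only at h3
    rw [← h3, h1]
    congr 1
    simp only [sub_smul]; abel
  -- `cₘ (cₘ - A)⁻¹ y → y`: clear on the domain, where the difference is `(cₘ - A)⁻¹ A y`; these
  -- operators are contractions, so density gives the rest.
  have hone : ∀ y, Filter.Tendsto (fun m => (c m : ℂ) • J m y) Filter.atTop (𝓝 y) := by
    intro y
    have hcJ : ∀ m w, ‖(c m : ℂ) • J m w‖ ≤ ‖w‖ := fun m w => by
      rw [norm_smul, Complex.norm_of_nonneg (hc m).le]; exact hJb m w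
    rw [Metric.tendsto_atTop]
    intro ε hε
    obtain ⟨z, hzD, hz⟩ := Metric.dense_iff.1 hD y (ε / 3) (by positivity)
    rw [Metric.mem_ball, dist_eq_norm] at hzD
    have hz0 : Filter.Tendsto (fun m => ‖A ⟨z, hz⟩‖ / c m) Filter.atTop (𝓝 0) :=
      hctop.const_div_atTop _
    obtain ⟨N, hN⟩ := (Metric.tendsto_atTop.1 hz0) (ε / 3) (by positivity)
    refine ⟨N, fun m hm => ?_⟩
    have h1 := hN m hm
    rw [Real.dist_eq, sub_zero, abs_of_nonneg (by have := hc m; positivity)] at h1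
    have h2 : ‖(c m : ℂ) • J m z - z‖ ≤ ‖A ⟨z, hz⟩‖ / c m := by
      rw [← hJA m ⟨z, hz⟩, le_div_iff₀' (hc m)]
      exact hJb m _
    have h3 := hcJ m (z - y)
    have e : (c m : ℂ) • J m y - y =
        -((c m : ℂ) • J m (z - y)) + ((c m : ℂ) • J m z - z) + (z - y) := by
      rw [map_sub, smul_sub]; abel
    rw [dist_eq_norm, e]
    have h4 := norm_add₃_le (a := -((c m : ℂ) • J m (z - y))) (b := (c m : ℂ) • J m z - z)
      (c := z - y)
    rw [norm_neg] at h4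
    linarith
  refine ⟨fun m => (c m : ℂ) • ((c m : ℂ) • J m - 1), fun m x => ?_, fun k m => ?_,
    fun m x => ?_, fun x => ?_⟩
  · obtain ⟨h, h'⟩ := hJ m x
    have h1 := hA ⟨_, h⟩
    set a := A ⟨_, h⟩
    set z := J m x
    have e : ((c m : ℂ) • ((c m : ℂ) • J m - 1)) x = (c m : ℂ) • a := by
      change (c m : ℂ) • ((c m : ℂ) • z - x) = _
      rw [← h']; congr 1; abel
    rw [e]
    nth_rw 1 [← h']
    rw [inner_sub_left, inner_smul_left, inner_smul_right, inner_smul_right, Complex.conj_ofReal,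
      inner_self_eq_norm_sq_to_K]
    have h2 : ((c m : ℂ) * ((‖a‖ : ℂ)) ^ 2).re = c m * ‖a‖ ^ 2 := by
      rw [← Complex.ofReal_pow, ← Complex.ofReal_mul, Complex.ofReal_re]
    simp only [Complex.coe_algebraMap, Complex.sub_re, Complex.re_ofReal_mul] at *
    have := hc m
    rw [h2]
    have h3 : c m * (c m * (inner ℂ z a).re) ≤ 0 :=
      mul_nonpos_of_nonneg_of_nonpos this.le (mul_nonpos_of_nonneg_of_nonpos this.le h1)
    have : 0 ≤ c m * ‖a‖ ^ 2 := by positivity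
    linarith
  · exact ((((hcomm k m).smul_left _).smul_right _).sub_left (Commute.one_left _)
      |>.sub_right (Commute.one_right _)).smul_left _ |>.smul_right _
  · have := hJA m x
    change ‖(c m : ℂ) • ((c m : ℂ) • J m x - x)‖ ≤ _
    rw [← this, norm_smul, Complex.norm_of_nonneg (hc m).le]
    exact hJb m _
  · have := hone (A x)
    refine this.congr fun m => ?_
    rw [hJA]; rfl

end Dissipative

/-! ### Generation and uniqueness of semigroups -/

section Generation

variable {E : Type*} [NormedAddCommGroup E] [InnerProductSpace ℂ E] [CompleteSpace E]

/-- **Lumer–Phillips theorem.** A densely defined dissipative operator `A` with `c - A` onto for all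
large `c` generates a strongly continuous semigroup of contractions. -/
theorem exists_contraction_semigroup {D : Submodule ℂ E} (hD : Dense (D : Set E)) {A : D →ₗ[ℂ] E}
    (hA : ∀ x : D, (inner ℂ (x : E) (A x)).re ≤ 0) {c₀ : ℝ}
    (hr : ∀ c ≥ c₀, ∀ y, ∃ x : D, (c : ℂ) • (x : E) - A x = y) :
    ∃ T : ℝ≥0 → E →L[ℂ] E, T 0 = 1 ∧ (∀ s t, T (s + t) = T s * T t) ∧
      (∀ x, Continuous fun t => T t x) ∧
      ∀ x y, (∃ h : x ∈ D, A ⟨x, h⟩ = y) ↔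
        Filter.Tendsto (fun h : ℝ≥0 => (((h : ℝ) : ℂ))⁻¹ • (T h x - x)) (𝓝[>] 0) (𝓝 y) := by
  obtain ⟨Y, hY, hYc, hYb, hYt⟩ := exists_yosida hD hA hr
  have hcau : ∀ (t : ℝ≥0) (x : E),
      ∃ y, Filter.Tendsto (fun m => NormedSpace.exp ((t : ℝ) • Y m) x) Filter.atTop (𝓝 y) := by
    intro t x
    refine cauchySeq_tendsto_of_complete ?_
    rw [Metric.cauchySeq_iff]
    intro ε hε
    obtain ⟨z, hzD, hz⟩ := Metric.dense_iff.1 hD x (ε / 3) (by positivity)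
    rw [Metric.mem_ball, dist_eq_norm] at hzD
    obtain ⟨N, hN⟩ := Metric.cauchySeq_iff.1 (hYt ⟨z, hz⟩).cauchySeq (ε / (3 * (t + 1)))
      (by positivity)
    refine ⟨N, fun k hk m hm => ?_⟩
    have h1 := hN k hk m hm
    rw [dist_eq_norm, lt_div_iff₀ (by positivity)] at h1
    have h2 := norm_exp_smul_sub_exp_smul_le (hY k) (hY m) (hYc k m) t.2 z
    have h3 := norm_exp_smul_apply_le (hY k) t.2 (z - x)
    have h4 := norm_exp_smul_apply_le (hY m) t.2 (z - x)
    set U := NormedSpace.exp ((t : ℝ) • Y k)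
    set V := NormedSpace.exp ((t : ℝ) • Y m)
    have e : U x - V x = (U z - V z) + (-(U (z - x)) + V (z - x)) := by
      simp only [map_sub]; abel
    rw [dist_eq_norm, e]
    have h5 := norm_add_le (U z - V z) (-(U (z - x)) + V (z - x))
    have h6 := norm_add_le (-(U (z - x))) (V (z - x))
    rw [norm_neg] at h6
    have h7 : ‖U z - V z‖ ≤ t * ‖Y k z - Y m z‖ := h2
    have h3' : ‖U (z - x)‖ ≤ ‖z - x‖ := h3
    have h4' : ‖V (z - x)‖ ≤ ‖z - x‖ := h4
    simp only at h1
    nlinarith [norm_nonneg (Y k z - Y m z), t.2]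
  choose f hf using hcau
  let T : ℝ≥0 → E →L[ℂ] E := fun t : ℝ≥0 =>
    continuousLinearMapOfTendsto (f := f t) (fun m => NormedSpace.exp ((t : ℝ) • Y m))
      (tendsto_pi_nhds.2 (hf t))
  have hT : ∀ (t : ℝ≥0) (x : E),
      Filter.Tendsto (fun m => NormedSpace.exp ((t : ℝ) • Y m) x) Filter.atTop (𝓝 (T t x)) := hf
  have hTb : ∀ (t : ℝ≥0) (x : E), ‖T t x‖ ≤ ‖x‖ := fun t x =>
    le_of_tendsto (hT t x).norm (Filter.Eventually.of_forall fun m =>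
      norm_exp_smul_apply_le (hY m) t.2 x)
  have hadd : ∀ s t, T (s + t) = T s * T t := by
    intro s t
    ext x
    refine tendsto_nhds_unique (hT (s + t) x) ?_
    have h1 : Filter.Tendsto (fun m => NormedSpace.exp ((s : ℝ) • Y m) (T t x) +
        NormedSpace.exp ((s : ℝ) • Y m) (NormedSpace.exp ((t : ℝ) • Y m) x - T t x))
        Filter.atTop (𝓝 (T s (T t x) + 0)) := by
      refine (hT s (T t x)).add ?_
      refine squeeze_zero_norm (fun m => norm_exp_smul_apply_le (hY m) s.2 _) ?_
      have := ((hT t x).sub_const (T t x)).norm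
      rwa [sub_self, norm_zero] at this
    rw [add_zero] at h1
    refine h1.congr fun m => ?_
    rw [← map_add, add_sub_cancel]
    have hc : Commute ((s : ℝ) • Y m) ((t : ℝ) • Y m) :=
      ((Commute.refl (Y m)).smul_left _).smul_right _
    let _ : NormedAlgebra ℚ (E →L[ℂ] E) := NormedAlgebra.restrictScalars ℚ ℝ (E →L[ℂ] E)
    rw [NNReal.coe_add, add_smul, NormedSpace.exp_add_of_commute hc]
    rfl
  have hzero : T 0 = 1 := by
    ext x
    refine tendsto_nhds_unique (hT 0 x) ?_
    simp
  have hlip : ∀ (t : ℝ≥0) (x : D), ‖T t x - x‖ ≤ t * ‖A x‖ := fun t x =>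
    le_of_tendsto ((hT t x).sub_const _).norm (Filter.Eventually.of_forall fun m =>
      (norm_exp_smul_sub_self_le (hY m) t.2 x).trans
        (mul_le_mul_of_nonneg_left (hYb m x) t.2))
  -- The Taylor estimate passes to the limit because `z` is fixed in the domain while the
  -- approximations converge at `x` and at `z`.
  have htay : ∀ (t : ℝ≥0) (x z : D),
      ‖T t x - x - (t : ℝ) • A x‖ ≤ (2 * ‖A x - z‖ + t * ‖A z‖) * t := fun t x z =>
    le_of_tendsto_of_tendsto (((hT t x).sub_const _).sub ((hYt x).const_smul (t : ℝ))).norm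
      (((((hYt x).sub_const (z : E)).norm.const_mul 2).add_const _).mul_const (t : ℝ))
      (Filter.Eventually.of_forall fun m =>
        (norm_exp_smul_sub_taylor_le (hY m) t.2 x z).trans
        (mul_le_mul_of_nonneg_right (add_le_add_right
          (mul_le_mul_of_nonneg_left (hYb m z) t.2) _) t.2))
  have hcont : ∀ x, Continuous fun t => T t x := by
    have hlip2 : ∀ (s t : ℝ≥0) (x : D), s ≤ t → ‖T t x - T s x‖ ≤ (t - s : ℝ) * ‖A x‖ := by
      intro s t x hst
      obtain ⟨r, rfl⟩ := exists_add_of_le hst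
      have e : T (s + r) (x : E) - T s x = T s (T r x - x) := by
        rw [hadd, map_sub]; rfl
      rw [e, NNReal.coe_add, add_sub_cancel_left]
      exact (hTb _ _).trans (hlip r x)
    intro x
    rw [Metric.continuous_iff]
    intro s ε hε
    obtain ⟨z, hzD, hz⟩ := Metric.dense_iff.1 hD x (ε / 3) (by positivity)
    rw [Metric.mem_ball, dist_eq_norm] at hzD
    refine ⟨ε / (3 * (‖A ⟨z, hz⟩‖ + 1)), by positivity, fun t ht => ?_⟩
    rw [NNReal.dist_eq, lt_div_iff₀ (by positivity)] at ht
    have h1 : ‖T t z - T s z‖ ≤ |(t : ℝ) - s| * ‖A ⟨z, hz⟩‖ := by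
      rcases le_total s t with h | h
      · rw [abs_of_nonneg (sub_nonneg.2 (NNReal.coe_le_coe.2 h))]
        exact hlip2 s t ⟨z, hz⟩ h
      · rw [abs_sub_comm, norm_sub_rev, abs_of_nonneg (sub_nonneg.2 (NNReal.coe_le_coe.2 h))]
        exact hlip2 t s ⟨z, hz⟩ h
    have e : T t x - T s x = (T t z - T s z) + (-(T t (z - x)) + T s (z - x)) := by
      simp only [map_sub]; abel
    rw [dist_eq_norm, e]
    have h5 := norm_add_le (T t z - T s z) (-(T t (z - x)) + T s (z - x))
    have h6 := norm_add_le (-(T t (z - x))) (T s (z - x))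
    rw [norm_neg] at h6
    have := hTb t (z - x)
    have := hTb s (z - x)
    have := abs_nonneg ((t : ℝ) - s)
    linarith
  have hgen : ∀ x : D, Filter.Tendsto (fun h : ℝ≥0 => (((h : ℝ) : ℂ))⁻¹ • (T h x - x))
      (𝓝[>] 0) (𝓝 (A x)) := by
    intro x
    rw [Metric.tendsto_nhdsWithin_nhds]
    intro ε hε
    obtain ⟨z, hzD, hz⟩ := Metric.dense_iff.1 hD (A x) (ε / 4) (by positivity)
    rw [Metric.mem_ball, dist_eq_norm, norm_sub_rev] at hzD
    refine ⟨ε / (2 * (‖A ⟨z, hz⟩‖ + 1)), by positivity, fun t ht0 ht => ?_⟩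
    have ht0' : (0 : ℝ) < t := ht0
    rw [NNReal.dist_eq, lt_div_iff₀ (by positivity), NNReal.coe_zero, sub_zero,
      abs_of_pos ht0'] at ht
    have h1 := htay t x ⟨z, hz⟩
    have e : (((t : ℝ) : ℂ))⁻¹ • (T t x - x) - A x =
        (((t : ℝ) : ℂ))⁻¹ • (T t x - x - (t : ℝ) • A x) := by
      rw [smul_sub _ (T t (x : E) - x), ← Complex.coe_smul, inv_smul_smul₀]
      exact_mod_cast ht0'.ne'
    rw [dist_eq_norm, e, norm_smul, norm_inv, Complex.norm_of_nonneg ht0'.le, inv_mul_lt_iff₀ ht0']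
    refine h1.trans_lt ?_
    rw [mul_comm]
    refine mul_lt_mul_of_pos_left ?_ ht0'
    simp only
    linarith
  refine ⟨T, hzero, hadd, hcont, fun x y => ⟨?_, fun hxy => ?_⟩⟩
  · rintro ⟨h, rfl⟩
    exact hgen ⟨x, h⟩
  · -- `z` solves `c z - A z = c x - y`; then `w = x - z` satisfies `c w ∈` generator at `w`, which
    -- contractivity of `T` only permits for `w = 0`.
    set c : ℝ := |c₀| + 1
    have hc : 0 < c := by positivity
    obtain ⟨z, hz⟩ := hr c (by have := le_abs_self c₀; simp only [c]; linarith) ((c : ℂ) • x - y)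
    set w := x - z with hw
    have hlim : Filter.Tendsto (fun h : ℝ≥0 => (((h : ℝ) : ℂ))⁻¹ • (T h w - w)) (𝓝[>] 0)
        (𝓝 ((c : ℂ) • w)) := by
      have h1 := hxy.sub (hgen z)
      have e : y - A z = (c : ℂ) • w := by
        rw [hw, smul_sub, ← sub_eq_zero]
        rw [← sub_eq_zero] at hz
        rw [← hz]; abel
      rw [e] at h1
      refine h1.congr fun h => ?_
      rw [← smul_sub, hw, map_sub]
      congr 1; abel
    have hre : Filter.Tendsto
        (fun h : ℝ≥0 => (inner ℂ w ((((h : ℝ) : ℂ))⁻¹ • (T h w - w))).re) (𝓝[>] 0)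
        (𝓝 (inner ℂ w ((c : ℂ) • w)).re) :=
      (Complex.continuous_re.tendsto _).comp (Filter.Tendsto.inner tendsto_const_nhds hlim)
    have hle : (inner ℂ w ((c : ℂ) • w)).re ≤ 0 := by
      refine le_of_tendsto hre (Filter.Eventually.of_forall fun h => ?_)
      rw [inner_smul_right, ← Complex.ofReal_inv, Complex.re_ofReal_mul, inner_sub_right,
        Complex.sub_re]
      refine mul_nonpos_of_nonneg_of_nonpos (by positivity) ?_
      have h1 := (Complex.re_le_norm _).trans (norm_inner_le_norm (𝕜 := ℂ) w (T h w))
      have h2 : (inner ℂ w w).re = ‖w‖ ^ 2 := inner_self_eq_norm_sq (𝕜 := ℂ) w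
      rw [h2]
      nlinarith [hTb h w, norm_nonneg w]
    have h2 : (inner ℂ w w).re = ‖w‖ ^ 2 := inner_self_eq_norm_sq (𝕜 := ℂ) w
    rw [inner_smul_right, Complex.re_ofReal_mul, h2] at hle
    have hw0 : w = 0 := by
      rw [← norm_eq_zero]
      have : ‖w‖ ^ 2 ≤ 0 := by nlinarith [sq_nonneg ‖w‖]
      exact pow_eq_zero_iff (two_ne_zero) |>.1 (le_antisymm this (sq_nonneg _))
    have hxz : x = z := sub_eq_zero.1 hw0
    refine ⟨hxz ▸ z.2, ?_⟩
    have e : (⟨x, hxz ▸ z.2⟩ : D) = z := Subtype.ext hxz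
    rw [e]
    rw [hxz] at hz
    exact sub_right_injective hz

/-- The Lumer–Phillips theorem for `-P` when `P` is bounded below in the sense of quadratic forms:
`-P - ω` generates a contraction semigroup, which is then rescaled by `e^{ωt}`. -/
theorem exists_isExpNegSemigroup {P : E →ₗ.[ℂ] E} (hD : Dense (P.domain : Set E)) {ω : ℝ}
    (hP : ∀ x : P.domain, -(ω * ‖(x : E)‖ ^ 2) ≤ (inner ℂ (x : E) (P x)).re) {c₀ : ℝ}
    (hr : ∀ c ≥ c₀, ∀ y, ∃ x : P.domain, (c : ℂ) • (x : E) + P x = y) :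
    ∃ T, IsExpNegSemigroup P T := by
  let A : P.domain →ₗ[ℂ] E := -P.toFun - (ω : ℂ) • P.domain.subtype
  have hAx : ∀ x, A x = -P x - (ω : ℂ) • (x : E) := fun _ => rfl
  obtain ⟨S, hS0, hSadd, hScont, hSgen⟩ := exists_contraction_semigroup hD (A := A) (c₀ := c₀ - ω)
    (fun x => by
      have h2 : (inner ℂ (x : E) (x : E)).re = ‖(x : E)‖ ^ 2 :=
        inner_self_eq_norm_sq (𝕜 := ℂ) (x : E)
      rw [hAx, inner_sub_right, inner_neg_right, inner_smul_right, Complex.sub_re, Complex.neg_re,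
        Complex.re_ofReal_mul, h2]
      linarith [hP x])
    (fun c hc y => by
      obtain ⟨x, hx⟩ := hr (c + ω) (by linarith) y
      refine ⟨x, ?_⟩
      rw [← hx, hAx, Complex.ofReal_add, add_smul]; abel)
  let e : ℝ≥0 → ℂ := fun t => Complex.exp ((ω : ℂ) * ((t : ℝ) : ℂ))
  have he : Continuous e := by fun_prop
  have he0 : e 0 = 1 := by simp [e]
  have hder : Filter.Tendsto (fun h : ℝ≥0 => (((h : ℝ) : ℂ))⁻¹ * (e h - 1)) (𝓝[>] 0)
      (𝓝 (ω : ℂ)) := by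
    have h1 : HasDerivAt (fun s : ℝ => Complex.exp ((ω : ℂ) * (s : ℂ))) (ω : ℂ) 0 := by
      have h2 : HasDerivAt (fun s : ℝ => (ω : ℂ) * (s : ℂ)) ω 0 := by
        simpa using (Complex.ofRealCLM.hasDerivAt (x := (0 : ℝ))).const_mul (ω : ℂ)
      simpa using h2.cexp
    have h2 := h1.tendsto_slope_zero_right
    have h3 : Filter.Tendsto (fun h : ℝ≥0 => (h : ℝ)) (𝓝[>] 0) (𝓝[>] 0) := by
      refine tendsto_nhdsWithin_iff.2 ⟨?_, ?_⟩
      · exact (NNReal.continuous_coe.tendsto 0).mono_left nhdsWithin_le_nhds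
      · filter_upwards [self_mem_nhdsWithin] with h hh
        exact hh
    refine (h2.comp h3).congr fun h => ?_
    simp [e]
  have he1 : Filter.Tendsto e (𝓝[>] 0) (𝓝 1) := by
    rw [← he0]; exact (he.tendsto 0).mono_left nhdsWithin_le_nhds
  refine ⟨fun t => e t • S t, ⟨?_, fun s t => ?_, fun x => ?_, fun x y => ?_⟩⟩
  · simp [he0, hS0]
  · have : e (s + t) = e s * e t := by
      simp only [e, NNReal.coe_add, Complex.ofReal_add, mul_add, Complex.exp_add]
    rw [this, hSadd, smul_mul_smul_comm]
  · exact he.smul (hScont x)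
  · have hiff : (x, y) ∈ (-P).graph ↔ ∃ h : x ∈ P.domain, A ⟨x, h⟩ = y - (ω : ℂ) • x := by
      rw [LinearPMap.mem_graph_iff]
      constructor
      · rintro ⟨z, rfl, hz⟩
        refine ⟨z.2, ?_⟩
        rw [hAx]
        simp only at hz
        rw [← hz]; rfl
      · rintro ⟨h, h'⟩
        exact ⟨⟨x, h⟩, rfl, by rw [hAx] at h'; exact sub_left_injective h'⟩
    rw [hiff, hSgen]
    constructor
    · intro hx
      have h1 := (he1.smul hx).add (hder.smul_const x)
      rw [one_smul, sub_add_cancel] at h1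
      refine h1.congr fun h => ?_
      simp only [smul_apply]
      module
    · intro hx
      have hinv : Filter.Tendsto (fun h => (e h)⁻¹) (𝓝[>] 0) (𝓝 1) := by
        simpa using he1.inv₀ one_ne_zero
      have h1 := hinv.smul (hx.sub (hder.smul_const x))
      rw [one_smul] at h1
      refine h1.congr fun h => ?_
      have hne : e h ≠ 0 := Complex.exp_ne_zero _
      rw [inv_smul_eq_iff₀ hne]
      simp only [smul_apply]
      module

end Generation

section Semigroup

variable {E : Type*} [NormedAddCommGroup E] [NormedSpace ℂ E]

theorem IsExpNegSemigroup.apply_mem_graph {P : E →ₗ.[ℂ] E} {T : ℝ≥0 → E →L[ℂ] E}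
    (hT : IsExpNegSemigroup P T) {x y : E} (hxy : (x, y) ∈ (-P).graph) (s : ℝ≥0) :
    (T s x, T s y) ∈ (-P).graph := by
  rw [hT.generator] at hxy ⊢
  refine (((T s).continuous.tendsto y).comp hxy).congr fun h => ?_
  have : T s (T h x) = T h (T s x) := by
    rw [← mul_apply_eq_comp, ← mul_apply_eq_comp, ← hT.map_add, ← hT.map_add, add_comm]
  rw [Function.comp, map_smul, map_sub, this]

/-- Orbits starting in the domain are differentiable from the right. One-sided derivatives suffice
for all mean value arguments below. -/
theorem IsExpNegSemigroup.hasDerivWithinAt {P : E →ₗ.[ℂ] E} {T : ℝ≥0 → E →L[ℂ] E}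
    (hT : IsExpNegSemigroup P T) {x y : E} (hxy : (x, y) ∈ (-P).graph) {s : ℝ} (hs : 0 ≤ s) :
    HasDerivWithinAt (fun r : ℝ => T r.toNNReal x) (T s.toNNReal y) (Set.Ici s) s := by
  rw [← hasDerivWithinAt_Ioi_iff_Ici, hasDerivWithinAt_iff_tendsto_slope' Set.self_notMem_Ioi]
  have hg := (hT.generator _ _).1 (hT.apply_mem_graph hxy s.toNNReal)
  have h3 : Filter.Tendsto (fun r : ℝ => (r - s).toNNReal) (𝓝[>] s) (𝓝[>] 0) := by
    refine tendsto_nhdsWithin_iff.2 ⟨?_, ?_⟩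
    · have : Continuous fun r : ℝ => (r - s).toNNReal := by fun_prop
      have h := this.tendsto s
      rw [sub_self, Real.toNNReal_zero] at h
      exact h.mono_left nhdsWithin_le_nhds
    · filter_upwards [self_mem_nhdsWithin] with r hr
      exact Real.toNNReal_pos.2 (sub_pos.2 hr)
  refine (hg.comp h3).congr' ?_
  filter_upwards [self_mem_nhdsWithin] with r hr
  have hrs : 0 ≤ r - s := (sub_pos.2 hr).le
  have e : T r.toNNReal x = T (r - s).toNNReal (T s.toNNReal x) := by
    rw [← mul_apply_eq_comp, ← hT.map_add, ← Real.toNNReal_add hrs hs, sub_add_cancel]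
  rw [Function.comp, slope_def_module, e, Real.coe_toNNReal _ hrs, ← Complex.ofReal_inv,
    Complex.coe_smul]

theorem IsExpNegSemigroup.continuous_toNNReal {P : E →ₗ.[ℂ] E} {T : ℝ≥0 → E →L[ℂ] E}
    (hT : IsExpNegSemigroup P T) (x : E) : Continuous fun r : ℝ => T r.toNNReal x :=
  (hT.continuous x).comp continuous_real_toNNReal

end Semigroup

/-- If `P` is bounded below, the semigroup generated by `-P` is unique: the difference `u` of two
orbits satisfies `d/ds ‖u‖² ≤ 2ω ‖u‖²`. -/
theorem IsExpNegSemigroup.unique {E : Type*} [NormedAddCommGroup E] [InnerProductSpace ℂ E]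
    {P : E →ₗ.[ℂ] E} (hD : Dense (P.domain : Set E)) {ω : ℝ}
    (hP : ∀ x : P.domain, -(ω * ‖(x : E)‖ ^ 2) ≤ (inner ℂ (x : E) (P x)).re)
    {S T : ℝ≥0 → E →L[ℂ] E} (hS : IsExpNegSemigroup P S) (hT : IsExpNegSemigroup P T) :
    S = T := by
  let _ : InnerProductSpace ℝ E := InnerProductSpace.complexToReal
  ext t x
  refine congrFun ((S t).continuous.ext_on hD (T t).continuous fun x hx => ?_) x
  have hgr : (x, -P ⟨x, hx⟩) ∈ (-P).graph := LinearPMap.mem_graph (-P) ⟨x, hx⟩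
  set y := -P ⟨x, hx⟩
  let u : ℝ → E := fun s => S s.toNNReal x - T s.toNNReal x
  let v : ℝ → E := fun s => S s.toNNReal y - T s.toNNReal y
  have hu : ∀ s, 0 ≤ s → HasDerivWithinAt u (v s) (Set.Ici s) s := fun s hs =>
    (hS.hasDerivWithinAt hgr hs).sub (hT.hasDerivWithinAt hgr hs)
  have huc : Continuous u := (hS.continuous_toNNReal x).sub (hT.continuous_toNNReal x)
  have hdiss : ∀ s, (inner ℂ (u s) (v s)).re ≤ ω * ‖u s‖ ^ 2 := by
    intro s
    have h : (u s, v s) ∈ (-P).graph :=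
      (-P).graph.sub_mem (hS.apply_mem_graph hgr s.toNNReal) (hT.apply_mem_graph hgr s.toNNReal)
    obtain ⟨z, hz, hz'⟩ := (LinearPMap.mem_graph_iff _).1 h
    simp only at hz hz'
    have h1 := hP z
    have h2 : (-P) z = -P z := rfl
    rw [← hz, ← hz', h2, inner_neg_right, Complex.neg_re]
    linarith
  have hw : ∀ s, 0 ≤ s → HasDerivWithinAt (fun s => Real.exp (-(2 * ω) * s) * ‖u s‖ ^ 2)
      (Real.exp (-(2 * ω) * s) * (-(2 * ω)) * ‖u s‖ ^ 2 +
        Real.exp (-(2 * ω) * s) * (2 * (inner ℂ (u s) (v s)).re)) (Set.Ici s) s := by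
    intro s hs
    have h1 : HasDerivAt (fun s => Real.exp (-(2 * ω) * s)) (Real.exp (-(2 * ω) * s) * (-(2 * ω)))
        s := by
      have := ((hasDerivAt_id s).const_mul (-(2 * ω))).exp
      simpa using this
    exact h1.hasDerivWithinAt.mul (hu s hs).norm_sq
  have hu0 : u 0 = 0 := by simp [u, hS.map_zero, hT.map_zero]
  have hFc : Continuous fun s : ℝ => Real.exp (-(2 * ω) * s) * ‖u s‖ ^ 2 := by fun_prop
  have hbound : ∀ s ∈ Set.Ico (0 : ℝ) t, Real.exp (-(2 * ω) * s) * (-(2 * ω)) * ‖u s‖ ^ 2 +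
      Real.exp (-(2 * ω) * s) * (2 * (inner ℂ (u s) (v s)).re) ≤ 0 := by
    intro s _
    have h1 := hdiss s
    have h2 := Real.exp_pos (-(2 * ω) * s)
    have h3 := mul_le_mul_of_nonneg_left h1 h2.le
    linarith
  have hle : Real.exp (-(2 * ω) * t) * ‖u t‖ ^ 2 ≤ 0 :=
    image_le_of_deriv_right_le_deriv_boundary (B := fun _ => (0 : ℝ)) (B' := fun _ => (0 : ℝ))
      hFc.continuousOn (fun s hs => hw s hs.1) (by simp [hu0]) continuousOn_const
      (fun s _ => hasDerivWithinAt_const _ _ _) hbound (Set.right_mem_Icc.2 t.2)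
  have h0 : ‖u t‖ ^ 2 ≤ 0 := by
    by_contra! h
    exact absurd hle (not_le.2 (mul_pos (Real.exp_pos _) h))
  have h1 : u t = 0 :=
    norm_eq_zero.1 (pow_eq_zero_iff two_ne_zero |>.1 (le_antisymm h0 (sq_nonneg _)))
  simpa [u, sub_eq_zero] using h1

/-! ### A criterion for trace-class operators -/

/-- If `∑ₖ ‖A fₖ‖ < ∞` for one Hilbert basis `(fₖ)`, then `A` is trace-class: `|A|^{1/2}` is
Hilbert–Schmidt, since `‖|A|^{1/2} fₖ‖² = ⟨fₖ, |A| fₖ⟩ ≤ ‖A fₖ‖`, and the Hilbert–Schmidt norm of a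
self-adjoint operator does not depend on the basis. -/
theorem isTraceClass_of_summable_norm {E : Type*} [NormedAddCommGroup E] [InnerProductSpace ℂ E]
    [CompleteSpace E] {κ : Type*} (f : HilbertBasis κ ℂ E) {A : E →L[ℂ] E}
    (hA : Summable fun k => ‖A (f k)‖) : IsTraceClass A := by
  intro ι e
  set B := CFC.abs A with hB
  set S := CFC.sqrt B with hS
  have hB0 : 0 ≤ B := CFC.abs_nonneg A
  have hSsa : IsSelfAdjoint S := IsSelfAdjoint.of_nonneg (CFC.sqrt_nonneg B)
  have hBsa : IsSelfAdjoint B := IsSelfAdjoint.of_nonneg hB0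
  have hSS : ∀ x, S (S x) = B x := fun x =>
    congrArg (fun Z : E →L[ℂ] E => Z x) (CFC.sqrt_mul_sqrt_self B)
  have hBB : ∀ x, B (B x) = (star A * A) x := fun x =>
    congrArg (fun Z : E →L[ℂ] E => Z x) (CFC.abs_mul_abs A)
  have hSin : ∀ x y, inner ℂ (S x) y = inner ℂ x (S y) := fun x y => by
    rw [← ContinuousLinearMap.adjoint_inner_right, ← ContinuousLinearMap.star_eq_adjoint,
      hSsa.star_eq]
  have hBin : ∀ x y, inner ℂ (B x) y = inner ℂ x (B y) := fun x y => by
    rw [← ContinuousLinearMap.adjoint_inner_right, ← ContinuousLinearMap.star_eq_adjoint,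
      hBsa.star_eq]
  have hSnorm : ∀ x, (inner ℂ x (B x)).re = ‖S x‖ ^ 2 := fun x => by
    rw [← hSS, ← hSin]
    exact inner_self_eq_norm_sq (𝕜 := ℂ) (S x)
  have hBnorm : ∀ x, ‖B x‖ = ‖A x‖ := fun x => by
    have h1 : (inner ℂ (B x) (B x)).re = ‖B x‖ ^ 2 := inner_self_eq_norm_sq (𝕜 := ℂ) (B x)
    have h2 : (inner ℂ (A x) (A x)).re = ‖A x‖ ^ 2 := inner_self_eq_norm_sq (𝕜 := ℂ) (A x)
    have h3 : inner ℂ (B x) (B x) = inner ℂ (A x) (A x) := by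
      rw [hBin, hBB, mul_apply_eq_comp, ContinuousLinearMap.star_eq_adjoint,
        ContinuousLinearMap.adjoint_inner_right]
    rw [h3, h2] at h1
    exact ((sq_eq_sq₀ (norm_nonneg _) (norm_nonneg _)).1 h1).symm
  have hf : Summable fun k => ‖S (f k)‖ ^ 2 := by
    refine Summable.of_nonneg_of_le (fun k => sq_nonneg _) (fun k => ?_) hA
    rw [← hSnorm, ← hBnorm]
    have h1 := (Complex.re_le_norm _).trans (norm_inner_le_norm (𝕜 := ℂ) (f k) (B (f k)))
    rwa [f.orthonormal.1 k, one_mul] at h1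
  have hpars : ∀ x, HasSum (fun k => ‖inner ℂ (f k) x‖ ^ 2) (‖x‖ ^ 2) := by
    intro x
    have h := (f.hasSum_inner_mul_inner x x).mapL Complex.reCLM
    have h2 : Complex.reCLM (inner ℂ x x) = ‖x‖ ^ 2 := inner_self_eq_norm_sq (𝕜 := ℂ) x
    rw [h2] at h
    refine h.congr_fun fun k => ?_
    rw [← inner_conj_symm x (f k), ← Complex.normSq_eq_conj_mul_self, Complex.normSq_eq_norm_sq]
    exact (Complex.ofReal_re _).symm
  simp only [hSnorm]
  refine summable_of_sum_le (c := ∑' k, ‖S (f k)‖ ^ 2) (fun i => sq_nonneg _) fun s => ?_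
  have h1 : HasSum (fun k => ∑ i ∈ s, ‖inner ℂ (f k) (S (e i))‖ ^ 2) (∑ i ∈ s, ‖S (e i)‖ ^ 2) :=
    hasSum_sum fun i _ => hpars _
  refine hasSum_le (fun k => ?_) h1 hf.hasSum
  have h2 := e.orthonormal.sum_inner_products_le (s := s) (S (f k))
  refine le_trans (le_of_eq (Finset.sum_congr rfl fun i _ => ?_)) h2
  rw [← hSin, norm_inner_symm]

/-! ### Normal form of the generalized Laplacian -/

section Graphs

variable {F : Type*} [AddCommGroup F] [Module ℂ F]

theorem mem_graph_add_iff {S T : F →ₗ.[ℂ] F} {x z : F} :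
    (x, z) ∈ (S + T).graph ↔ ∃ u v, (x, u) ∈ S.graph ∧ (x, v) ∈ T.graph ∧ z = u + v := by
  simp only [LinearPMap.mem_graph_iff]
  constructor
  · rintro ⟨w, rfl, rfl⟩
    exact ⟨S ⟨w, w.2.1⟩, T ⟨w, w.2.2⟩, ⟨⟨w, w.2.1⟩, rfl, rfl⟩, ⟨⟨w, w.2.2⟩, rfl, rfl⟩, rfl⟩
  · rintro ⟨u, v, ⟨w, rfl, rfl⟩, ⟨⟨_, hw⟩, rfl, rfl⟩, rfl⟩
    exact ⟨⟨w, w.2, hw⟩, rfl, rfl⟩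

theorem mem_graph_smul_iff {c : ℂ} {S : F →ₗ.[ℂ] F} {x z : F} :
    (x, z) ∈ (c • S).graph ↔ ∃ u, (x, u) ∈ S.graph ∧ z = c • u := by
  simp only [LinearPMap.mem_graph_iff]
  constructor
  · rintro ⟨w, rfl, rfl⟩
    exact ⟨S w, ⟨w, rfl, rfl⟩, rfl⟩
  · rintro ⟨u, ⟨w, rfl, rfl⟩, rfl⟩
    exact ⟨w, rfl, rfl⟩

theorem mem_graph_sum_iff {ι : Type*} {s : Finset ι} {S : ι → F →ₗ.[ℂ] F} {x z : F} :
    (x, z) ∈ (∑ i ∈ s, S i).graph ↔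
      ∃ u : ι → F, (∀ i ∈ s, (x, u i) ∈ (S i).graph) ∧ z = ∑ i ∈ s, u i := by
  classical
  induction s using Finset.induction_on generalizing z with
  | empty =>
    simp only [Finset.sum_empty, LinearPMap.mem_graph_iff]
    constructor
    · rintro ⟨w, rfl, rfl⟩
      exact ⟨0, by simp, rfl⟩
    · rintro ⟨u, -, rfl⟩
      exact ⟨⟨x, Submodule.mem_top⟩, rfl, rfl⟩
  | insert i s hi ih =>
    rw [Finset.sum_insert hi, mem_graph_add_iff]
    constructor
    · rintro ⟨v, w, hv, hw, rfl⟩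
      obtain ⟨u, hu, rfl⟩ := ih.1 hw
      refine ⟨Function.update u i v, fun j hj => ?_, ?_⟩
      · rcases eq_or_ne j i with rfl | hji
        · simpa using hv
        · rw [Function.update_of_ne hji]
          exact hu j (Finset.mem_of_mem_insert_of_ne hj hji)
      · rw [Finset.sum_insert hi, Function.update_self]
        congr 1
        refine Finset.sum_congr rfl fun j hj => ?_
        rw [Function.update_of_ne (ne_of_mem_of_not_mem hj hi)]
    · rintro ⟨u, hu, rfl⟩
      exact ⟨u i, ∑ j ∈ s, u j, hu i (Finset.mem_insert_self i s),
        ih.2 ⟨u, fun j hj => hu j (Finset.mem_insert_of_mem hj), rfl⟩, Finset.sum_insert hi⟩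

theorem mem_graph_pmapComp_iff {S T : F →ₗ.[ℂ] F} {x z : F} :
    (x, z) ∈ (pmapComp S T).graph ↔ ∃ y, (x, y) ∈ T.graph ∧ (y, z) ∈ S.graph := by
  simp only [LinearPMap.mem_graph_iff]
  constructor
  · rintro ⟨w, rfl, rfl⟩
    exact ⟨T ⟨w, mem_domain_of_comp w.2⟩, ⟨_, rfl, rfl⟩, ⟨⟨_, apply_mem_of_comp w.2⟩, rfl, rfl⟩⟩
  · rintro ⟨y, ⟨w, rfl, rfl⟩, ⟨⟨_, hv⟩, rfl, rfl⟩⟩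
    exact ⟨⟨w, w, hv, rfl⟩, rfl, rfl⟩

end Graphs

variable {n : ℕ}

theorem mem_graph_ofBounded_iff {A : GNS n →L[ℂ] GNS n} {x z : GNS n} :
    (x, z) ∈ (ofBounded A).graph ↔ z = A x := by
  rw [LinearPMap.mem_graph_iff]
  constructor
  · rintro ⟨w, rfl, rfl⟩; rfl
  · rintro rfl; exact ⟨⟨x, Submodule.mem_top⟩, rfl, rfl⟩

/-- `y = δ_μ x`, coefficientwise; since `y` lies in `ℓ²`, this includes `x ∈ dom δ_μ`. -/
def IsDeriv (μ : Fin n) (x y : GNS n) : Prop :=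
  ∀ k, y k = Complex.I * (k μ : ℂ) * x k

theorem mem_graph_deriv_iff {μ : Fin n} {x y : GNS n} :
    (x, y) ∈ (deriv μ).graph ↔ IsDeriv μ x y := by
  rw [LinearPMap.mem_graph_iff]
  constructor
  · rintro ⟨w, rfl, rfl⟩ k; rfl
  · intro h
    have he : (fun k : Fin n → ℤ => Complex.I * (k μ : ℂ) * x k) = y := funext fun k => (h k).symm
    have hx : x ∈ (deriv μ).domain := by
      change Memℓp _ 2
      rw [he]; exact lp.memℓp y
    exact ⟨⟨x, hx⟩, rfl, lp.ext he⟩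

theorem IsDeriv.add {μ : Fin n} {x y x' y' : GNS n} (h : IsDeriv μ x y) (h' : IsDeriv μ x' y') :
    IsDeriv μ (x + x') (y + y') := fun k => by
  rw [lp.coeFn_add, lp.coeFn_add, Pi.add_apply, Pi.add_apply, h, h', mul_add]

theorem IsDeriv.sub {μ : Fin n} {x y x' y' : GNS n} (h : IsDeriv μ x y) (h' : IsDeriv μ x' y') :
    IsDeriv μ (x - x') (y - y') := fun k => by
  rw [lp.coeFn_sub, lp.coeFn_sub, Pi.sub_apply, Pi.sub_apply, h, h', mul_sub]

theorem IsDeriv.eq {μ : Fin n} {x y y' : GNS n} (h : IsDeriv μ x y) (h' : IsDeriv μ x y') :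
    y = y' := lp.ext (funext fun k => (h k).trans (h' k).symm)

theorem norm_intCast_apply_le (k : Fin n → ℤ) (μ : Fin n) : ‖(k μ : ℂ)‖ ≤ ‖k‖ := by
  rw [Complex.norm_intCast, ← Int.norm_eq_abs]
  exact norm_le_pi_norm k μ

/-- The derivation `∂_μ U_k = i k_μ U_k` of the smooth torus. -/
def SmoothTorus.partialDeriv {Θ : Matrix (Fin n) (Fin n) ℝ} (μ : Fin n) (a : SmoothTorus Θ) :
    SmoothTorus Θ where
  coeff k := Complex.I * (k μ : ℂ) * a.coeff k
  decay N := by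
    obtain ⟨C, hC⟩ := a.decay (N + 1)
    refine ⟨C, fun k => le_trans ?_ (hC k)⟩
    rw [norm_mul, norm_mul, Complex.norm_I, one_mul, pow_succ, mul_assoc]
    have : ‖(k μ : ℂ)‖ ≤ 1 + ‖k‖ := (norm_intCast_apply_le k μ).trans (by linarith)
    gcongr

theorem summable_mul_shift {Θ : Matrix (Fin n) (Fin n) ℝ} (a : SmoothTorus Θ)
    {w : (Fin n → ℤ) → ℂ} (hw : ∀ k, ‖w k‖ = 1) (x : GNS n) (m : Fin n → ℤ) :
    Summable fun k => a.coeff k * (w k * x (m - k)) := by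
  refine Summable.of_norm_bounded (a.summable_norm.mul_right ‖x‖) fun k => ?_
  rw [norm_mul, norm_mul, hw, one_mul]
  exact mul_le_mul_of_nonneg_left (lp.norm_apply_le_norm two_ne_zero x _) (norm_nonneg _)

theorem tsum_leibniz {Θ : Matrix (Fin n) (Fin n) ℝ} (a : SmoothTorus Θ)
    {w : (Fin n → ℤ) → ℂ} (hw : ∀ k, ‖w k‖ = 1) {μ : Fin n} {x y : GNS n} (h : IsDeriv μ x y)
    (m : Fin n → ℤ) :
    ∑' k, a.coeff k * (w k * y (m - k)) + ∑' k, (a.partialDeriv μ).coeff k * (w k * x (m - k)) =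
      Complex.I * (m μ : ℂ) * ∑' k, a.coeff k * (w k * x (m - k)) := by
  rw [← (summable_mul_shift a hw y m).tsum_add (summable_mul_shift _ hw x m), ← tsum_mul_left]
  refine tsum_congr fun k => ?_
  rw [h, SmoothTorus.partialDeriv, Pi.sub_apply]
  push_cast
  ring

/-- Leibniz rule `δ_μ (a x) = a δ_μ x + (∂_μ a) x`. -/
theorem IsDeriv.L {Θ : Matrix (Fin n) (Fin n) ℝ} (a : SmoothTorus Θ) {μ : Fin n} {x y : GNS n}
    (h : IsDeriv μ x y) : IsDeriv μ (L a x) (L a y + L (a.partialDeriv μ) x) := fun m => by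
  rw [lp.coeFn_add, Pi.add_apply, L_apply, L_apply, L_apply, ← mul_add,
    tsum_leibniz a (fun k => norm_phase Θ k (m - k)) h m]
  ring

/-- Leibniz rule `δ_μ (x a) = (δ_μ x) a + x ∂_μ a`. -/
theorem IsDeriv.R {Θ : Matrix (Fin n) (Fin n) ℝ} (a : SmoothTorus Θ) {μ : Fin n} {x y : GNS n}
    (h : IsDeriv μ x y) : IsDeriv μ (R a x) (R a y + R (a.partialDeriv μ) x) := fun m => by
  rw [lp.coeFn_add, Pi.add_apply, R_apply, R_apply, R_apply, ← mul_add,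
    tsum_leibniz a (fun k => norm_phase Θ (m - k) k) h m]
  ring

section Coefficients

variable {Θ : Matrix (Fin n) (Fin n) ℝ} (g : Matrix (Fin n) (Fin n) ℝ)
  (lam rho : Fin n → SmoothTorus Θ) (l₁ r₁ l₂ r₂ : SmoothTorus Θ)

/-- The connection form `b_μ = L(λ_μ) - R(ρ_μ)`, so that `∇_μ = δ_μ + b_μ`. -/
def connection (μ : Fin n) : GNS n →L[ℂ] GNS n := L (lam μ) - R (rho μ)

/-- The commutator `[δ_μ, b_ν] = L(∂_μ λ_ν) - R(∂_μ ρ_ν)`. -/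
def connectionDeriv (μ ν : Fin n) : GNS n →L[ℂ] GNS n :=
  L ((lam ν).partialDeriv μ) - R ((rho ν).partialDeriv μ)

/-- The coefficient of `δ_μ` in `-P`. -/
def firstOrderCoeff (μ : Fin n) : GNS n →L[ℂ] GNS n :=
  ∑ ν, ((g μ ν : ℂ) + (g ν μ : ℂ)) • connection lam rho ν

/-- The part of order zero of `-P`. -/
def zeroOrderCoeff : GNS n →L[ℂ] GNS n :=
  ∑ μ, ∑ ν, (g μ ν : ℂ) •
    (connectionDeriv lam rho μ ν + connection lam rho μ * connection lam rho ν) +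
  potential l₁ r₁ l₂ r₂

variable {lam rho}

/-- Leibniz rule `δ_μ b_ν = b_ν δ_μ + [δ_μ, b_ν]`. -/
theorem IsDeriv.connection {μ ν : Fin n} {x y : GNS n} (h : IsDeriv μ x y) :
    IsDeriv μ (connection lam rho ν x)
      (NCTorus.connection lam rho ν y + connectionDeriv lam rho μ ν x) := by
  have := (h.L (lam ν)).sub (h.R (rho ν))
  rwa [add_sub_add_comm] at this

theorem mem_graph_nabla_iff {ν : Fin n} {x z : GNS n} :
    (x, z) ∈ (nabla lam rho ν).graph ↔ ∃ y, IsDeriv ν x y ∧ z = y + connection lam rho ν x := by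
  simp only [nabla, mem_graph_add_iff, mem_graph_deriv_iff, mem_graph_ofBounded_iff]
  constructor
  · rintro ⟨y, v, hy, rfl, rfl⟩; exact ⟨y, hy, rfl⟩
  · rintro ⟨y, hy, rfl⟩; exact ⟨y, _, hy, rfl, rfl⟩

variable (lam rho)

/-- `-P` in normal form: `-P = ∑ g^{μν} δ_μ δ_ν + ∑ C_μ δ_μ + D` with bounded `C_μ`, `D`, on
the domain of those `x` for which all `δ_μ δ_ν x` exist in `H_τ`. -/
theorem mem_graph_neg_genLaplacian_iff {x z : GNS n} :
    (x, z) ∈ (-genLaplacian g lam rho l₁ r₁ l₂ r₂).graph ↔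
      ∃ (d : Fin n → GNS n) (e : Fin n → Fin n → GNS n), (∀ ν, IsDeriv ν x (d ν)) ∧
        (∀ μ ν, IsDeriv μ (d ν) (e μ ν)) ∧
        z = ∑ μ, ∑ ν, (g μ ν : ℂ) • e μ ν + ∑ μ, firstOrderCoeff g lam rho μ (d μ) +
          zeroOrderCoeff g lam rho l₁ r₁ l₂ r₂ x := by
  have key : ∀ (d : Fin n → GNS n) (e : Fin n → Fin n → GNS n),
      ∑ μ, ∑ ν, (g μ ν : ℂ) • ((e μ ν + (connection lam rho ν (d μ) +
        connectionDeriv lam rho μ ν x)) + connection lam rho μ (d ν + connection lam rho ν x)) +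
        potential l₁ r₁ l₂ r₂ x =
      ∑ μ, ∑ ν, (g μ ν : ℂ) • e μ ν + ∑ μ, firstOrderCoeff g lam rho μ (d μ) +
          zeroOrderCoeff g lam rho l₁ r₁ l₂ r₂ x := by
    intro d e
    simp only [firstOrderCoeff, zeroOrderCoeff, sum_apply, add_apply,
      smul_apply, mul_apply_eq_comp, add_smul, smul_add, map_add, Finset.sum_add_distrib]
    rw [Finset.sum_comm (f := fun μ ν => (g ν μ : ℂ) • connection lam rho ν (d μ))]
    abel
  rw [genLaplacian, neg_neg]
  simp only [mem_graph_add_iff, mem_graph_sum_iff, mem_graph_smul_iff, mem_graph_pmapComp_iff,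
    mem_graph_nabla_iff, mem_graph_ofBounded_iff, Finset.mem_univ, true_imp_iff]
  constructor
  · rintro ⟨-, -, ⟨u, hu, rfl⟩, rfl, rfl⟩
    choose u' hu' hu'' using hu
    choose u₂ hu₂ hg using hu'
    choose w hw y hy he using hu₂
    choose d hd hdw using hw
    -- the derivative `δ_ν x` produced from the pair `(μ, ν)` does not depend on `μ`
    have hd' : ∀ μ ν, d μ ν = d ν ν := fun μ ν => (hd μ ν).eq (hd ν ν)
    have hb : ∀ μ ν, IsDeriv μ (connection lam rho ν x) _ := fun μ ν =>
      (hd μ μ).connection (lam := lam) (rho := rho) (ν := ν)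
    refine ⟨fun ν => d ν ν, fun μ ν => y μ ν - (connection lam rho ν (d μ μ) +
      connectionDeriv lam rho μ ν x), fun ν => hd ν ν, fun μ ν => ?_, ?_⟩
    · have := (hy μ ν).sub (hb μ ν)
      rwa [hdw, add_sub_cancel_right, hd'] at this
    · rw [← key]
      simp only [hu'', hg, he, hdw, sub_add_cancel]
      refine congrArg (· + _) (Finset.sum_congr rfl fun μ _ => Finset.sum_congr rfl fun ν _ => ?_)
      rw [hd' μ ν]
  · rintro ⟨d, e, hd, he, rfl⟩
    refine ⟨_, _, ⟨fun μ => ∑ ν, (g μ ν : ℂ) • ((e μ ν + (connection lam rho ν (d μ) +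
        connectionDeriv lam rho μ ν x)) + connection lam rho μ (d ν + connection lam rho ν x)),
      fun μ => ⟨fun ν => (g μ ν : ℂ) • ((e μ ν + (connection lam rho ν (d μ) +
        connectionDeriv lam rho μ ν x)) + connection lam rho μ (d ν + connection lam rho ν x)),
        fun ν => ⟨_, ⟨d ν + connection lam rho ν x, ⟨d ν, hd ν, rfl⟩,
          _, (he μ ν).add (hd μ).connection, rfl⟩, rfl⟩, rfl⟩, rfl⟩, rfl, (key d e).symm⟩

end Coefficients

/-! ### Ellipticity, Gårding's inequality and the resolvent -/

section Symbol

variable {n : ℕ}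

/-- The principal symbol `∑ g^{μν} k_μ k_ν` of `P`. -/
def symbol (g : Matrix (Fin n) (Fin n) ℝ) (k : Fin n → ℤ) : ℝ :=
  ∑ μ, ∑ ν, g μ ν * (k μ * k ν)

/-- Ellipticity of the principal symbol, by compactness of the unit sphere. -/
theorem exists_le_symbol {g : Matrix (Fin n) (Fin n) ℝ} (hg : g.PosDef) :
    ∃ c : ℝ, 0 < c ∧ ∀ k : Fin n → ℤ, c * ‖k‖ ^ 2 ≤ symbol g k := by
  let f : (Fin n → ℝ) → ℝ := fun v => ∑ μ, ∑ ν, g μ ν * (v μ * v ν)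
  have hf : ∀ v, f v = star v ⬝ᵥ g.mulVec v := by
    intro v
    simp only [f, dotProduct, Matrix.mulVec, Finset.mul_sum, Pi.star_apply, star_trivial]
    refine Finset.sum_congr rfl fun μ _ => Finset.sum_congr rfl fun ν _ => by ring
  have hcont : Continuous f := by fun_prop
  have hpos : ∀ v ∈ Metric.sphere (0 : Fin n → ℝ) 1, 0 < f v := by
    intro v hv
    rw [hf]
    exact hg.dotProduct_mulVec_pos (ne_zero_of_mem_unit_sphere ⟨v, hv⟩)
  obtain ⟨c, hc, hcf⟩ : ∃ c : ℝ, 0 < c ∧ ∀ v ∈ Metric.sphere (0 : Fin n → ℝ) 1, c ≤ f v :=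
    (isCompact_sphere _ _).exists_forall_le' hcont.continuousOn hpos
  refine ⟨c, hc, fun k => ?_⟩
  let v : Fin n → ℝ := fun i => k i
  have hv : ‖v‖ = ‖k‖ := by simp only [v, Pi.norm_def]; rfl
  change c * ‖k‖ ^ 2 ≤ f v
  rw [← hv]
  rcases (norm_nonneg v).eq_or_lt with h0 | h0
  · have : v = 0 := norm_eq_zero.1 h0.symm
    simp [this, f]
  · have h1 := hcf (‖v‖⁻¹ • v) (by
      rw [mem_sphere_zero_iff_norm, norm_smul, norm_inv, norm_norm, inv_mul_cancel₀ h0.ne'])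
    have h2 : f (‖v‖⁻¹ • v) = f v / ‖v‖ ^ 2 := by
      simp only [f, Finset.sum_div, Pi.smul_apply, smul_eq_mul]
      refine Finset.sum_congr rfl fun μ _ => Finset.sum_congr rfl fun ν _ => ?_
      field_simp
    rwa [h2, le_div_iff₀ (by positivity)] at h1

theorem abs_intCast_apply_le (k : Fin n → ℤ) (μ : Fin n) : |(k μ : ℝ)| ≤ ‖k‖ := by
  have := norm_intCast_apply_le k μ
  rwa [Complex.norm_intCast] at this

theorem exists_sum_sq_le_symbol {g : Matrix (Fin n) (Fin n) ℝ} (hg : g.PosDef) :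
    ∃ c : ℝ, 0 < c ∧ ∀ k : Fin n → ℤ, c * ∑ μ, (k μ : ℝ) ^ 2 ≤ symbol g k := by
  obtain ⟨c, hc, h⟩ := exists_le_symbol hg
  refine ⟨c / (n + 1), by positivity, fun k => le_trans ?_ (h k)⟩
  have h1 : ∑ μ, (k μ : ℝ) ^ 2 ≤ (n + 1) * ‖k‖ ^ 2 := by
    calc ∑ μ, (k μ : ℝ) ^ 2 ≤ ∑ _μ : Fin n, ‖k‖ ^ 2 := Finset.sum_le_sum fun μ _ => by
          rw [← sq_abs]
          exact pow_le_pow_left₀ (abs_nonneg _) (abs_intCast_apply_le k μ) 2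
      _ = n * ‖k‖ ^ 2 := by simp
      _ ≤ _ := by nlinarith [sq_nonneg ‖k‖]
  calc c / (n + 1) * ∑ μ, (k μ : ℝ) ^ 2 ≤ c / (n + 1) * ((n + 1) * ‖k‖ ^ 2) := by gcongr
    _ = c * ‖k‖ ^ 2 := by field_simp

theorem symbol_nonneg {g : Matrix (Fin n) (Fin n) ℝ} (hg : g.PosDef) (k : Fin n → ℤ) :
    0 ≤ symbol g k := by
  obtain ⟨c, hc, h⟩ := exists_le_symbol hg
  exact le_trans (by positivity) (h k)

/-- First order symbols are small relative to `r + symbol g` for large `r`. -/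
theorem exists_small_resolvent_symbol {g : Matrix (Fin n) (Fin n) ℝ} (hg : g.PosDef) {ε : ℝ}
    (hε : 0 < ε) : ∃ r₀ : ℝ, 0 < r₀ ∧ ∀ r ≥ r₀, ∀ k : Fin n → ℤ,
      1 ≤ ε * (r + symbol g k) ∧ ∀ μ, |(k μ : ℝ)| ≤ ε * (r + symbol g k) := by
  obtain ⟨c, hc, h⟩ := exists_le_symbol hg
  refine ⟨1 / ε + 1 / (4 * ε ^ 2 * c), by positivity, fun r hr k => ⟨?_, fun μ => ?_⟩⟩
  · have h1 : 1 / ε ≤ r := le_trans (by have : 0 < 1 / (4 * ε ^ 2 * c) := by positivity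
                                        linarith) hr
    rw [div_le_iff₀' hε] at h1
    have := mul_nonneg hε.le (symbol_nonneg hg k)
    linarith
  · have h1 : 1 / (4 * ε ^ 2 * c) ≤ r := le_trans (by have : 0 < 1 / ε := by positivity
                                                      linarith) hr
    have h2 : ε * (1 / (4 * ε ^ 2 * c)) ≤ ε * r := by gcongr
    have h3 : ε * (c * ‖k‖ ^ 2) ≤ ε * symbol g k := by gcongr; exact h k
    have h4 : ‖k‖ ≤ ε * (c * ‖k‖ ^ 2) + ε * (1 / (4 * ε ^ 2 * c)) := by
      have : ε * (c * ‖k‖ ^ 2) + ε * (1 / (4 * ε ^ 2 * c)) - ‖k‖ =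
          ε * c * (‖k‖ - 1 / (2 * ε * c)) ^ 2 := by field_simp; ring
      have : 0 ≤ ε * c * (‖k‖ - 1 / (2 * ε * c)) ^ 2 := by positivity
      linarith
    have := abs_intCast_apply_le k μ
    linarith

/-- The Fourier multiplier `U_k ↦ m_k U_k` for a bounded sequence `m`. -/
def multiplier (m : (Fin n → ℤ) → ℂ) {C : ℝ} (hC : ∀ k, ‖m k‖ ≤ C) : GNS n →L[ℂ] GNS n :=
  lp.mapCLM 2 (fun k => m k • ContinuousLinearMap.id ℂ ℂ) ((norm_nonneg _).trans (hC 0)) fun k => by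
    rw [norm_smul]
    exact (mul_le_of_le_one_right (norm_nonneg _) ContinuousLinearMap.norm_id_le).trans (hC k)

theorem multiplier_apply (m : (Fin n → ℤ) → ℂ) {C : ℝ} (hC : ∀ k, ‖m k‖ ≤ C) (x : GNS n)
    (k : Fin n → ℤ) : multiplier m hC x k = m k * x k := rfl

theorem norm_multiplier_le (m : (Fin n → ℤ) → ℂ) {C : ℝ} (hC : ∀ k, ‖m k‖ ≤ C) :
    ‖multiplier m hC‖ ≤ C := lp.norm_mapCLM_le _ _ _ _

/-- The Weyl unitary `U_k` as a vector of `H_τ`. -/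
def weyl (k : Fin n → ℤ) : GNS n := lp.single 2 k 1

theorem norm_weyl (k : Fin n → ℤ) : ‖weyl k‖ = 1 := by
  rw [weyl, lp.norm_single (by norm_num), norm_one]

theorem weyl_apply_mul (k m : Fin n → ℤ) (f : (Fin n → ℤ) → ℂ) :
    f m * (weyl k : GNS n) m = f k * (weyl k : GNS n) m := by
  rcases eq_or_ne m k with rfl | h
  · rfl
  · rw [weyl, lp.single_apply_ne _ _ _ h, mul_zero, mul_zero]

theorem isDeriv_weyl (μ : Fin n) (k : Fin n → ℤ) :
    IsDeriv μ (weyl k) ((Complex.I * (k μ : ℂ)) • weyl k) := fun m => by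
  rw [weyl_apply_mul k m fun m => Complex.I * (m μ : ℂ)]
  rfl

theorem IsDeriv.smul {μ : Fin n} {x y : GNS n} (c : ℂ) (h : IsDeriv μ x y) :
    IsDeriv μ (c • x) (c • y) := fun k => by
  rw [lp.coeFn_smul, lp.coeFn_smul, Pi.smul_apply, Pi.smul_apply, h, smul_eq_mul, smul_eq_mul]
  ring

theorem dense_of_weyl_mem {D : Submodule ℂ (GNS n)} (h : ∀ k, weyl k ∈ D) :
    Dense (D : Set (GNS n)) := by
  intro x
  refine mem_closure_of_tendsto (lp.hasSum_single (by norm_num) x)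
    (Filter.Eventually.of_forall fun s => D.sum_mem fun i _ => ?_)
  have : lp.single 2 i (x i) = x i • (weyl i : GNS n) := by
    rw [weyl, ← lp.single_smul, smul_eq_mul, mul_one]
  rw [this]
  exact D.smul_mem _ (h i)

theorem sum_smul_apply_eq_symbol (g : Matrix (Fin n) (Fin n) ℝ) {x : GNS n} {d : Fin n → GNS n}
    {e : Fin n → Fin n → GNS n} (hd : ∀ ν, IsDeriv ν x (d ν))
    (he : ∀ μ ν, IsDeriv μ (d ν) (e μ ν)) (k : Fin n → ℤ) :
    (∑ μ, ∑ ν, (g μ ν : ℂ) • e μ ν : GNS n) k = -(symbol g k : ℂ) * x k := by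
  simp only [lp.coeFn_sum, Finset.sum_apply, lp.coeFn_smul, Pi.smul_apply, smul_eq_mul, symbol,
    Complex.ofReal_sum, ← Finset.sum_neg_distrib, Finset.sum_mul]
  refine Finset.sum_congr rfl fun μ _ => Finset.sum_congr rfl fun ν _ => ?_
  rw [he, hd]
  push_cast
  linear_combination (g μ ν : ℂ) * k μ * k ν * x k * Complex.I_mul_I

end Symbol

section Laplacian

variable {n : ℕ} {Θ : Matrix (Fin n) (Fin n) ℝ} {g : Matrix (Fin n) (Fin n) ℝ}
  {lam rho : Fin n → SmoothTorus Θ} {l₁ r₁ l₂ r₂ : SmoothTorus Θ}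

/-- `(-P) U_k`. -/
theorem weyl_mem_graph (k : Fin n → ℤ) :
    (weyl k, -(symbol g k : ℂ) • weyl k +
        ∑ μ, (Complex.I * (k μ : ℂ)) • firstOrderCoeff g lam rho μ (weyl k) +
        zeroOrderCoeff g lam rho l₁ r₁ l₂ r₂ (weyl k)) ∈
      (-genLaplacian g lam rho l₁ r₁ l₂ r₂).graph := by
  rw [mem_graph_neg_genLaplacian_iff]
  have hd : ∀ ν, IsDeriv ν (weyl k) ((Complex.I * (k ν : ℂ)) • weyl k) :=
    fun ν => isDeriv_weyl ν k
  have he : ∀ μ ν, IsDeriv μ ((Complex.I * (k ν : ℂ)) • weyl k)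
      ((Complex.I * (k ν : ℂ)) • (Complex.I * (k μ : ℂ)) • weyl k) :=
    fun μ ν => (isDeriv_weyl μ k).smul _
  refine ⟨_, _, hd, he, ?_⟩
  simp only [map_smul]
  congr 2
  ext m
  rw [sum_smul_apply_eq_symbol g hd he, lp.coeFn_smul, Pi.smul_apply, smul_eq_mul,
    weyl_apply_mul k m fun m => -(symbol g m : ℂ)]

theorem dense_genLaplacian_domain :
    Dense ((genLaplacian g lam rho l₁ r₁ l₂ r₂).domain : Set (GNS n)) :=
  dense_of_weyl_mem fun k => by
    have := LinearPMap.mem_domain_of_mem_graph (weyl_mem_graph (g := g) (lam := lam) (rho := rho)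
      (l₁ := l₁) (r₁ := r₁) (l₂ := l₂) (r₂ := r₂) k)
    exact this

/-- Gårding's inequality: `Re ⟨x, P x⟩ ≥ -ω ‖x‖²`. -/
theorem exists_genLaplacian_lower_bound (hg : g.PosDef) :
    ∃ ω : ℝ, ∀ x : (genLaplacian g lam rho l₁ r₁ l₂ r₂).domain, -(ω * ‖(x : GNS n)‖ ^ 2) ≤
      (inner ℂ (x : GNS n) (genLaplacian g lam rho l₁ r₁ l₂ r₂ x)).re := by
  obtain ⟨c, hc, hcs⟩ := exists_sum_sq_le_symbol hg
  obtain ⟨C, hC⟩ : ∃ C, C = firstOrderCoeff g lam rho := ⟨_, rfl⟩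
  obtain ⟨Z, hZ⟩ : ∃ Z, Z = zeroOrderCoeff g lam rho l₁ r₁ l₂ r₂ := ⟨_, rfl⟩
  refine ⟨∑ μ, ‖C μ‖ ^ 2 / (4 * c) + ‖Z‖, fun x => ?_⟩
  have hgr := LinearPMap.mem_graph (-genLaplacian g lam rho l₁ r₁ l₂ r₂) x
  rw [mem_graph_neg_genLaplacian_iff, ← hC, ← hZ] at hgr
  obtain ⟨d, e, hd, he, hz⟩ := hgr
  rw [LinearPMap.neg_apply, neg_eq_iff_eq_neg] at hz
  rw [hz, inner_neg_right, Complex.neg_re, neg_le_neg_iff]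
  generalize (x : GNS n) = x at *
  have hsq : ∀ y : GNS n, HasSum (fun k => ‖y k‖ ^ 2) (‖y‖ ^ 2) := by
    intro y
    have := lp.hasSum_norm (p := 2) (by norm_num) y
    simpa using this
  -- the principal part dominates `c ∑ ‖δ_μ x‖²`; the first order part is absorbed by Young's
  -- inequality
  have hprin : (inner ℂ x (∑ μ, ∑ ν, (g μ ν : ℂ) • e μ ν)).re ≤ -(c * ∑ μ, ‖d μ‖ ^ 2) := by
    have h1 := (lp.hasSum_inner x (∑ μ, ∑ ν, (g μ ν : ℂ) • e μ ν)).mapL Complex.reCLM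
    have h2 : HasSum (fun k => -(c * ∑ μ, ‖d μ k‖ ^ 2)) (-(c * ∑ μ, ‖d μ‖ ^ 2)) :=
      ((hasSum_sum fun μ _ => hsq (d μ)).mul_left c).neg
    refine hasSum_le (fun k => ?_) h1 h2
    rw [sum_smul_apply_eq_symbol g hd he]
    have e1 : Complex.reCLM (inner ℂ (x k) (-(symbol g k : ℂ) * x k)) =
        -(symbol g k * ‖x k‖ ^ 2) := by
      have : (inner ℂ (x k) (-(symbol g k : ℂ) * x k) : ℂ) =
          ((-(symbol g k * ‖x k‖ ^ 2) : ℝ) : ℂ) := by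
        rw [RCLike.inner_apply, mul_assoc, Complex.mul_conj, Complex.normSq_eq_norm_sq]
        push_cast; ring
      rw [this]; exact Complex.ofReal_re _
    have e2 : ∑ μ, ‖d μ k‖ ^ 2 = (∑ μ, (k μ : ℝ) ^ 2) * ‖x k‖ ^ 2 := by
      rw [Finset.sum_mul]
      refine Finset.sum_congr rfl fun μ _ => ?_
      rw [hd, norm_mul, norm_mul, Complex.norm_I, one_mul, mul_pow, Complex.norm_intCast, sq_abs]
    rw [e1, e2, neg_le_neg_iff, ← mul_assoc]
    exact mul_le_mul_of_nonneg_right (hcs k) (sq_nonneg _)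
  have hre : ∀ y : GNS n, (inner ℂ x y).re ≤ ‖x‖ * ‖y‖ := fun y =>
    (Complex.re_le_norm _).trans (norm_inner_le_norm _ _)
  have hfirst : ∀ μ,
      (inner ℂ x (C μ (d μ))).re ≤ ‖C μ‖ ^ 2 / (4 * c) * ‖x‖ ^ 2 + c * ‖d μ‖ ^ 2 := by
    intro μ
    have h1 := (hre (C μ (d μ))).trans
      (mul_le_mul_of_nonneg_left ((C μ).le_opNorm (d μ)) (norm_nonneg x))
    have h2 : ‖C μ‖ ^ 2 / (4 * c) * ‖x‖ ^ 2 + c * ‖d μ‖ ^ 2 - ‖x‖ * (‖C μ‖ * ‖d μ‖) =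
        c * (‖d μ‖ - ‖C μ‖ * ‖x‖ / (2 * c)) ^ 2 := by field_simp; ring
    have h3 : 0 ≤ c * (‖d μ‖ - ‖C μ‖ * ‖x‖ / (2 * c)) ^ 2 := by positivity
    linarith
  have hzero : (inner ℂ x (Z x)).re ≤ ‖Z‖ * ‖x‖ ^ 2 := by
    have h1 := (hre (Z x)).trans (mul_le_mul_of_nonneg_left (Z.le_opNorm x) (norm_nonneg x))
    linarith
  have hsum := Finset.sum_le_sum fun μ (_ : μ ∈ Finset.univ) => hfirst μ
  rw [Finset.sum_add_distrib, ← Finset.sum_mul, ← Finset.mul_sum] at hsum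
  rw [inner_add_right, inner_add_right, Complex.add_re, Complex.add_re, add_mul,
    inner_sum (f := fun μ => C μ (d μ)), Complex.re_sum]
  linarith

/-- `r + P` is onto for large `r`: with `G` the inverse of `r - ∑ g^{μν} δ_μ δ_ν`, one has
`(r + P) G = 1 - K` with `‖K‖ < 1`. -/
theorem exists_genLaplacian_surjective (hg : g.PosDef) :
    ∃ r₀ : ℝ, ∀ r ≥ r₀, ∀ y : GNS n, ∃ x : (genLaplacian g lam rho l₁ r₁ l₂ r₂).domain,
      (r : ℂ) • (x : GNS n) + genLaplacian g lam rho l₁ r₁ l₂ r₂ x = y := by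
  obtain ⟨C, hC⟩ : ∃ C, C = firstOrderCoeff g lam rho := ⟨_, rfl⟩
  obtain ⟨Z, hZ⟩ : ∃ Z, Z = zeroOrderCoeff g lam rho l₁ r₁ l₂ r₂ := ⟨_, rfl⟩
  set N := ∑ μ, ‖C μ‖ + ‖Z‖ with hN
  have hN0 : 0 ≤ N := by positivity
  obtain ⟨ε, hε, hεN⟩ : ∃ ε : ℝ, 0 < ε ∧ ε * N < 1 :=
    ⟨1 / (N + 1), by positivity, by rw [one_div_mul_eq_div, div_lt_one (by positivity)]; linarith⟩
  obtain ⟨r₀, hr₀, hr⟩ := exists_small_resolvent_symbol hg hε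
  refine ⟨r₀, fun r hrr y => ?_⟩
  have hpos : ∀ k, 0 < r + symbol g k := fun k => by
    have := symbol_nonneg hg k
    linarith
  have hnorm : ∀ k, ‖((r + symbol g k : ℝ) : ℂ)‖ = r + symbol g k := fun k =>
    Complex.norm_of_nonneg (hpos k).le
  have hm₀ : ∀ k : Fin n → ℤ, ‖(((r + symbol g k : ℝ) : ℂ))⁻¹‖ ≤ ε := fun k => by
    rw [norm_inv, hnorm, inv_le_iff_one_le_mul₀ (hpos k)]
    exact (hr r hrr k).1
  have hm₁ : ∀ (μ : Fin n) (k : Fin n → ℤ),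
      ‖Complex.I * (k μ : ℂ) * (((r + symbol g k : ℝ) : ℂ))⁻¹‖ ≤ ε := fun μ k => by
    rw [norm_mul, norm_mul, Complex.norm_I, one_mul, norm_inv, hnorm, Complex.norm_intCast,
      ← div_eq_mul_inv, div_le_iff₀ (hpos k)]
    exact (hr r hrr k).2 μ
  obtain ⟨κ, hκ⟩ : ∃ κ : ℝ, ∀ (μ ν : Fin n) (k : Fin n → ℤ), ‖Complex.I * (k μ : ℂ) *
      (Complex.I * (k ν : ℂ) * (((r + symbol g k : ℝ) : ℂ))⁻¹)‖ ≤ κ := by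
    obtain ⟨c, hc, hcs⟩ := exists_le_symbol hg
    refine ⟨1 / c, fun μ ν k => ?_⟩
    rw [norm_mul, norm_mul, norm_mul, norm_mul, Complex.norm_I, one_mul, one_mul, norm_inv, hnorm,
      Complex.norm_intCast, Complex.norm_intCast, ← mul_assoc, ← div_eq_mul_inv,
      div_le_div_iff₀ (hpos k) hc, one_mul]
    have h1 : |(k μ : ℝ)| * |(k ν : ℝ)| ≤ ‖k‖ * ‖k‖ :=
      mul_le_mul (abs_intCast_apply_le k μ) (abs_intCast_apply_le k ν) (abs_nonneg _)
        (norm_nonneg _)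
    have h2 := mul_le_mul_of_nonneg_right h1 hc.le
    linarith [hcs k]
  let G := multiplier _ hm₀
  let G₁ := fun μ => multiplier _ (hm₁ μ)
  let G₂ := fun μ ν => multiplier _ (hκ μ ν)
  let K := ∑ μ, C μ * G₁ μ + Z * G
  have hK : ‖K‖ < 1 := by
    refine lt_of_le_of_lt ?_ hεN
    have h1 : ∀ μ, ‖C μ * G₁ μ‖ ≤ ε * ‖C μ‖ := fun μ => by
      rw [mul_comm]
      exact (norm_mul_le _ _).trans
        (mul_le_mul_of_nonneg_left (norm_multiplier_le _ _) (norm_nonneg _))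
    have h2 : ‖Z * G‖ ≤ ε * ‖Z‖ := by
      rw [mul_comm]
      exact (norm_mul_le _ _).trans
        (mul_le_mul_of_nonneg_left (norm_multiplier_le _ _) (norm_nonneg _))
    rw [hN, mul_add, Finset.mul_sum]
    exact (norm_add_le _ _).trans (add_le_add ((norm_sum_le _ _).trans
      (Finset.sum_le_sum fun μ _ => h1 μ)) h2)
  -- `x = G v` with `v = (1 - K)⁻¹ y` solves `(r + P) x = y`
  let u := Units.oneSub K hK
  set v := (↑u⁻¹ : GNS n →L[ℂ] GNS n) y with hv
  have hvy : v - K v = y := by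
    have h1 : (u : GNS n →L[ℂ] GNS n) * ↑u⁻¹ = 1 := u.mul_inv
    exact congrArg (fun X : GNS n →L[ℂ] GNS n => X y) h1
  have hd : ∀ ν, IsDeriv ν (G v) (G₁ ν v) := fun ν k => by
    simp only [G, G₁, multiplier_apply, mul_assoc]
  have he : ∀ μ ν, IsDeriv μ (G₁ ν v) (G₂ μ ν v) := fun μ ν k => by
    simp only [G₂, G₁, multiplier_apply, mul_assoc]
  have hgr := (mem_graph_neg_genLaplacian_iff g lam rho l₁ r₁ l₂ r₂).2
    ⟨fun ν => G₁ ν v, fun μ ν => G₂ μ ν v, hd, he, rfl⟩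
  obtain ⟨x, hx, hx'⟩ := (LinearPMap.mem_graph_iff _).1 hgr
  refine ⟨x, ?_⟩
  rw [LinearPMap.neg_apply, neg_eq_iff_eq_neg] at hx'
  simp only at hx hx'
  rw [hx', hx, ← hvy]
  have h1 : (r : ℂ) • G v - ∑ μ, ∑ ν, (g μ ν : ℂ) • G₂ μ ν v = v := by
    ext k
    rw [lp.coeFn_sub, Pi.sub_apply, sum_smul_apply_eq_symbol g hd he, lp.coeFn_smul,
      Pi.smul_apply, smul_eq_mul]
    have hne : ((r + symbol g k : ℝ) : ℂ) ≠ 0 := by exact_mod_cast (hpos k).ne'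
    simp only [G, multiplier_apply]
    field_simp
    push_cast
    ring
  have h2 : K v = ∑ μ, C μ (G₁ μ v) + Z (G v) := by
    simp only [K, add_apply, sum_apply, mul_apply_eq_comp]
  have h3 : ∀ a b c d w : GNS n, a - b = w → a + -(b + c + d) = w - (c + d) := by
    rintro a b c d _ rfl; abel
  rw [h2, ← hC, ← hZ]
  exact h3 _ _ _ _ _ h1

end Laplacian

/-! ### Polynomial decay of Fourier columns and smoothing -/

section Tame

variable {n : ℕ}

/-- Bounded operators `X` that preserve polynomial decay of Fourier columns: if
`‖S U_m‖ = O((1 + |m|)^{-a})` then `‖S X U_m‖ = O((1 + |m|)^{-a})`, uniformly in `S`. This holds if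
the matrix of `X` decays rapidly off the diagonal, and it is visibly stable under products. -/
def IsTame (X : GNS n →L[ℂ] GNS n) : Prop :=
  ∀ a : ℕ, ∃ C : ℝ, 0 ≤ C ∧ ∀ (S : GNS n →L[ℂ] GNS n) (Φ : ℝ), 0 ≤ Φ →
    (∀ m, ‖S (weyl m)‖ ≤ Φ * ((1 + ‖m‖) ^ a)⁻¹) →
    ∀ m, ‖S (X (weyl m))‖ ≤ C * Φ * ((1 + ‖m‖) ^ a)⁻¹

theorem IsTame.zero : IsTame (0 : GNS n →L[ℂ] GNS n) := fun a =>
  ⟨0, le_rfl, fun S Φ _ _ m => by simp⟩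

theorem IsTame.one : IsTame (1 : GNS n →L[ℂ] GNS n) := fun a =>
  ⟨1, zero_le_one, fun S Φ _ h m => by simpa using h m⟩

theorem IsTame.add {X Y : GNS n →L[ℂ] GNS n} (hX : IsTame X) (hY : IsTame Y) : IsTame (X + Y) := by
  intro a
  obtain ⟨C, hC, h⟩ := hX a
  obtain ⟨C', hC', h'⟩ := hY a
  refine ⟨C + C', by positivity, fun S Φ hΦ hS m => ?_⟩
  rw [add_apply, map_add, add_mul, add_mul]
  exact (norm_add_le _ _).trans (add_le_add (h S Φ hΦ hS m) (h' S Φ hΦ hS m))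

theorem IsTame.smul {X : GNS n →L[ℂ] GNS n} (c : ℂ) (hX : IsTame X) : IsTame (c • X) := by
  intro a
  obtain ⟨C, hC, h⟩ := hX a
  refine ⟨‖c‖ * C, by positivity, fun S Φ hΦ hS m => ?_⟩
  rw [smul_apply, map_smul, norm_smul, mul_assoc, mul_assoc, ← mul_assoc C]
  exact mul_le_mul_of_nonneg_left (h S Φ hΦ hS m) (norm_nonneg _)

theorem IsTame.sub {X Y : GNS n →L[ℂ] GNS n} (hX : IsTame X) (hY : IsTame Y) : IsTame (X - Y) := by
  have := hX.add (hY.smul (-1))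
  rwa [neg_one_smul, ← sub_eq_add_neg] at this

theorem IsTame.mul {X Y : GNS n →L[ℂ] GNS n} (hX : IsTame X) (hY : IsTame Y) : IsTame (X * Y) := by
  intro a
  obtain ⟨C, hC, h⟩ := hX a
  obtain ⟨C', hC', h'⟩ := hY a
  refine ⟨C' * C, by positivity, fun S Φ hΦ hS m => ?_⟩
  rw [mul_assoc C']
  exact h' (S.comp X) (C * Φ) (by positivity) (h S Φ hΦ hS) m

theorem IsTame.sum {ι : Type*} {s : Finset ι} {X : ι → GNS n →L[ℂ] GNS n}
    (h : ∀ i ∈ s, IsTame (X i)) : IsTame (∑ i ∈ s, X i) :=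
  Finset.sum_induction X IsTame (fun _ _ => IsTame.add) IsTame.zero h

theorem weightedShift_weyl (k : Fin n → ℤ) (c : (Fin n → ℤ) → ℂ) (hc : ∀ m, ‖c m‖ = 1)
    (m : Fin n → ℤ) : weightedShift k c hc (weyl m) = c m • weyl (m + k) := by
  ext j
  change c (j - k) * weyl m (j - k) = c m * weyl (m + k) j
  rw [weyl_apply_mul]
  congr 1
  rcases eq_or_ne j (m + k) with rfl | h
  · rw [add_sub_cancel_right]
    simp [weyl]
  · have h' : j - k ≠ m := fun h' => h (by rw [← h', sub_add_cancel])
    rw [weyl, weyl, lp.single_apply_ne _ _ _ h, lp.single_apply_ne _ _ _ h']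

theorem one_add_norm_le_mul {V : Type*} [SeminormedAddCommGroup V] (j m : V) :
    1 + ‖m‖ ≤ (1 + ‖j‖) * (1 + ‖m + j‖) := by
  have h := norm_sub_le (m + j) j
  rw [add_sub_cancel_right] at h
  nlinarith [norm_nonneg j, norm_nonneg (m + j), mul_nonneg (norm_nonneg j) (norm_nonneg (m + j))]

/-- Peetre's inequality: `(1 + |m + j|)⁻¹ ≤ (1 + |j|) (1 + |m|)⁻¹`. -/
theorem inv_pow_one_add_norm_le {V : Type*} [SeminormedAddCommGroup V] (j m : V) (a : ℕ) :
    ((1 + ‖m + j‖) ^ a)⁻¹ ≤ (1 + ‖j‖) ^ a * ((1 + ‖m‖) ^ a)⁻¹ := by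
  rw [← div_eq_mul_inv, le_div_iff₀ (by positivity), inv_mul_le_iff₀ (by positivity), mul_comm,
    ← mul_pow]
  exact pow_le_pow_left₀ (by positivity) (one_add_norm_le_mul j m) a

/-- A series `∑ f_k W_k` of shifts with rapidly decreasing coefficients is tame, by Peetre's
inequality. -/
theorem isTame_tsum_shift {Θ : Matrix (Fin n) (Fin n) ℝ} (f : SmoothTorus Θ)
    {W : (Fin n → ℤ) → GNS n →L[ℂ] GNS n} (hW : ∀ k, ‖W k‖ ≤ 1)
    (hWs : ∀ k m, ∃ c : ℂ, ‖c‖ = 1 ∧ W k (weyl m) = c • weyl (m + k)) :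
    IsTame (∑' k, f.coeff k • W k) := by
  intro a
  have hs := f.summable_weight a
  refine ⟨∑' j, (1 + ‖j‖) ^ a * ‖f.coeff j‖, tsum_nonneg fun j => by positivity,
    fun S Φ hΦ hS m => ?_⟩
  have h2 := ((f.summable_smul W hW).hasSum.mapL
    (ContinuousLinearMap.apply ℂ (GNS n) (weyl m))).mapL S
  have h3 : HasSum (fun j => (1 + ‖j‖) ^ a * ‖f.coeff j‖ * (Φ * ((1 + ‖m‖) ^ a)⁻¹))
      ((∑' j, (1 + ‖j‖) ^ a * ‖f.coeff j‖) * (Φ * ((1 + ‖m‖) ^ a)⁻¹)) := hs.hasSum.mul_right _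
  rw [mul_assoc]
  refine le_trans (le_of_eq (congrArg norm h2.tsum_eq.symm)) (tsum_of_norm_bounded h3 fun j => ?_)
  change ‖S (f.coeff j • W j (weyl m))‖ ≤ _
  obtain ⟨c, hc, hcw⟩ := hWs j m
  rw [hcw, map_smul, map_smul, norm_smul, norm_smul, hc, one_mul]
  calc ‖f.coeff j‖ * ‖S (weyl (m + j))‖
      ≤ ‖f.coeff j‖ * (Φ * ((1 + ‖j‖) ^ a * ((1 + ‖m‖) ^ a)⁻¹)) := by
        gcongr
        exact (hS _).trans (mul_le_mul_of_nonneg_left (inv_pow_one_add_norm_le j m a) hΦ)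
    _ = _ := by ring

theorem isTame_L {Θ : Matrix (Fin n) (Fin n) ℝ} (f : SmoothTorus Θ) : IsTame (L f) :=
  (isTame_tsum_shift f (norm_leftWeyl_le Θ) fun k m =>
    ⟨phase Θ k m, norm_phase Θ k m, weightedShift_weyl k (phase Θ k) (norm_phase Θ k) m⟩).smul _

theorem isTame_R {Θ : Matrix (Fin n) (Fin n) ℝ} (f : SmoothTorus Θ) : IsTame (R f) :=
  (isTame_tsum_shift f (norm_rightWeyl_le Θ) fun k m =>
    ⟨phase Θ m k, norm_phase Θ m k,
      weightedShift_weyl k (fun m => phase Θ m k) (fun m => norm_phase Θ m k) m⟩).smul _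

variable {Θ : Matrix (Fin n) (Fin n) ℝ} (g : Matrix (Fin n) (Fin n) ℝ)
  (lam rho : Fin n → SmoothTorus Θ) (l₁ r₁ l₂ r₂ : SmoothTorus Θ)

theorem isTame_connection (μ : Fin n) : IsTame (connection lam rho μ) :=
  (isTame_L _).sub (isTame_R _)

theorem isTame_firstOrderCoeff (μ : Fin n) : IsTame (firstOrderCoeff g lam rho μ) :=
  IsTame.sum fun ν _ => (isTame_connection lam rho ν).smul _

theorem isTame_zeroOrderCoeff : IsTame (zeroOrderCoeff g lam rho l₁ r₁ l₂ r₂) :=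
  (IsTame.sum fun μ _ => IsTame.sum fun ν _ => (((isTame_L _).sub (isTame_R _)).add
    ((isTame_connection lam rho μ).mul (isTame_connection lam rho ν))).smul _).add
  (((isTame_L _).sub (isTame_R _)).add ((isTame_L _).mul (isTame_R _)))

/-- The lower order part of `-P`, shifted by `1`, applied to `U_k`:
`(-P) U_k = -(q(k) + 1) U_k + lowerOrder k`. -/
def lowerOrder (k : Fin n → ℤ) : GNS n :=
  ∑ μ, (Complex.I * (k μ : ℂ)) • firstOrderCoeff g lam rho μ (weyl k) +
    (zeroOrderCoeff g lam rho l₁ r₁ l₂ r₂ + 1) (weyl k)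

variable {g lam rho l₁ r₁ l₂ r₂}

theorem exists_norm_apply_lowerOrder_le (a : ℕ) :
    ∃ C : ℝ, 0 ≤ C ∧ ∀ (S : GNS n →L[ℂ] GNS n) (Φ : ℝ), 0 ≤ Φ →
      (∀ m, ‖S (weyl m)‖ ≤ Φ * ((1 + ‖m‖) ^ a)⁻¹) →
      ∀ k, ‖S (lowerOrder g lam rho l₁ r₁ l₂ r₂ k)‖ ≤
        C * Φ * ((1 + ‖k‖) * ((1 + ‖k‖) ^ a)⁻¹) := by
  choose C hC h using fun μ => isTame_firstOrderCoeff g lam rho μ a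
  obtain ⟨C', hC', h'⟩ := ((isTame_zeroOrderCoeff g lam rho l₁ r₁ l₂ r₂).add IsTame.one) a
  refine ⟨∑ μ, C μ + C', add_nonneg (Finset.sum_nonneg fun μ _ => hC μ) hC',
    fun S Φ hΦ hS k => ?_⟩
  have hk : 0 ≤ Φ * ((1 + ‖k‖) ^ a)⁻¹ := by positivity
  have h1 : ∀ μ, ‖S ((Complex.I * (k μ : ℂ)) • firstOrderCoeff g lam rho μ (weyl k))‖ ≤
      C μ * (Φ * ((1 + ‖k‖) * ((1 + ‖k‖) ^ a)⁻¹)) := fun μ => by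
    rw [map_smul, norm_smul, norm_mul, Complex.norm_I, one_mul]
    calc ‖(k μ : ℂ)‖ * ‖S (firstOrderCoeff g lam rho μ (weyl k))‖
        ≤ (1 + ‖k‖) * (C μ * Φ * ((1 + ‖k‖) ^ a)⁻¹) :=
          mul_le_mul ((norm_intCast_apply_le k μ).trans (by linarith)) (h μ S Φ hΦ hS k)
            (norm_nonneg _) (by positivity)
      _ = _ := by ring
  have h2 : ‖S ((zeroOrderCoeff g lam rho l₁ r₁ l₂ r₂ + 1) (weyl k))‖ ≤
      C' * (Φ * ((1 + ‖k‖) * ((1 + ‖k‖) ^ a)⁻¹)) := by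
    refine (h' S Φ hΦ hS k).trans ?_
    have : (0 : ℝ) ≤ ‖k‖ * (C' * (Φ * ((1 + ‖k‖) ^ a)⁻¹)) := by positivity
    linarith
  rw [lowerOrder, map_add, map_sum, mul_assoc, add_mul, Finset.sum_mul]
  exact (norm_add_le _ _).trans (add_le_add ((norm_sum_le _ _).trans
    (Finset.sum_le_sum fun μ _ => h1 μ)) h2)

theorem weyl_mem_graph_lowerOrder (k : Fin n → ℤ) :
    (weyl k, -((symbol g k + 1 : ℝ) : ℂ) • weyl k + lowerOrder g lam rho l₁ r₁ l₂ r₂ k) ∈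
      (-genLaplacian g lam rho l₁ r₁ l₂ r₂).graph := by
  have h := weyl_mem_graph (g := g) (lam := lam) (rho := rho) (l₁ := l₁) (r₁ := r₁) (l₂ := l₂)
    (r₂ := r₂) k
  convert h using 2
  rw [lowerOrder, add_apply, one_apply_eq_self, Complex.ofReal_add, Complex.ofReal_one]
  module

end Tame

section Smoothing

/-- If `-P x = -p x + y`, then `T(t) x` is controlled by `T` on `y` alone, up to an exponentially
small term, with a gain of `p⁻¹`. -/
theorem IsExpNegSemigroup.norm_apply_le {E : Type*} [NormedAddCommGroup E] [NormedSpace ℂ E]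
    {P : E →ₗ.[ℂ] E} {T : ℝ≥0 → E →L[ℂ] E} (hT : IsExpNegSemigroup P T) {x y : E} {p : ℝ}
    (hp : 0 < p) (hxy : (x, -(p : ℂ) • x + y) ∈ (-P).graph) {t₀ t K : ℝ} (ht₀ : 0 ≤ t₀)
    (ht : t₀ ≤ t) (hK : ∀ s ∈ Set.Icc t₀ t, ‖T s.toNNReal y‖ ≤ K) :
    ‖T t.toNNReal x‖ ≤ Real.exp (-(p * (t - t₀))) * ‖T t₀.toNNReal x‖ + K / p := by
  have hK0 : 0 ≤ K := (norm_nonneg _).trans (hK t ⟨ht, le_rfl⟩)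
  let w : ℝ → ℝ := fun s => Real.exp (p * (s - t))
  have hw : ∀ s, HasDerivAt w (w s * p) s := fun s => by
    have := (((hasDerivAt_id s).sub_const t).const_mul p).exp
    simpa [w] using this
  let φ : ℝ → E := fun s => w s • T s.toNNReal x
  have hφ : ∀ s ∈ Set.Ico t₀ t, HasDerivWithinAt φ (w s • T s.toNNReal y) (Set.Ici s) s := by
    intro s hs
    have h := (hw s).hasDerivWithinAt.smul (hT.hasDerivWithinAt hxy (ht₀.trans hs.1))
    refine h.congr_deriv ?_
    rw [_root_.map_add, map_smul, mul_smul, ← Complex.coe_smul p]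
    module
  have hφc : ContinuousOn φ (Set.Icc t₀ t) := by
    have := hT.continuous_toNNReal x
    have hwc : Continuous w := by fun_prop
    exact (hwc.smul this).continuousOn
  let B : ℝ → ℝ := fun s => ‖φ t₀‖ + K / p * (w s - w t₀)
  have hB : ∀ s, HasDerivAt B (K * w s) s := fun s => by
    have := (((hw s).sub_const (w t₀)).const_mul (K / p)).const_add ‖φ t₀‖
    refine this.congr_deriv ?_
    field_simp
  have hle := image_norm_le_of_norm_deriv_right_le_deriv_boundary hφc hφ (B := B) (by simp [B]) hB
    (fun s hs => by
      rw [norm_smul, Real.norm_of_nonneg (Real.exp_pos _).le, mul_comm]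
      exact mul_le_mul_of_nonneg_right (hK s ⟨hs.1, hs.2.le⟩) (Real.exp_pos _).le)
    (Set.right_mem_Icc.2 ht)
  have hwt : w t = 1 := by simp [w]
  have hwt₀ : w t₀ = Real.exp (-(p * (t - t₀))) := by
    simp only [w]; congr 1; ring
  have h0 : 0 ≤ K / p * w t₀ := mul_nonneg (by positivity) (Real.exp_pos _).le
  simp only [φ, B, hwt, one_smul, norm_smul, Real.norm_of_nonneg (Real.exp_pos _).le,
    hwt₀] at hle h0
  linarith

/-- Local boundedness of a strongly continuous semigroup, by the uniform boundedness principle. -/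
theorem IsExpNegSemigroup.exists_norm_le {E : Type*} [NormedAddCommGroup E] [NormedSpace ℂ E]
    [CompleteSpace E] {P : E →ₗ.[ℂ] E} {T : ℝ≥0 → E →L[ℂ] E} (hT : IsExpNegSemigroup P T)
    (τ : ℝ≥0) : ∃ M : ℝ, ∀ s ≤ τ, ‖T s‖ ≤ M := by
  obtain ⟨M, hM⟩ := banach_steinhaus (g := fun s : Set.Iic τ => T s) fun x => by
    have hc : IsCompact (Set.Icc 0 τ) := isCompact_Icc
    obtain ⟨C, hC⟩ := hc.exists_bound_of_continuousOn (hT.continuous x).continuousOn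
    exact ⟨C, fun s => hC s ⟨zero_le, s.2⟩⟩
  exact ⟨M, fun s hs => hM ⟨s, hs⟩⟩

theorem exp_neg_le_div_pow {y : ℝ} (hy : 0 < y) (a : ℕ) :
    Real.exp (-y) ≤ a.factorial * (y ^ a)⁻¹ := by
  have h := Real.pow_div_factorial_le_exp y hy.le a
  rw [Real.exp_neg, ← div_eq_mul_inv, ← inv_div]
  exact inv_anti₀ (by positivity) h

variable {n : ℕ} {Θ : Matrix (Fin n) (Fin n) ℝ} {g : Matrix (Fin n) (Fin n) ℝ}
  {lam rho : Fin n → SmoothTorus Θ} {l₁ r₁ l₂ r₂ : SmoothTorus Θ}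

theorem exists_mul_sq_le_symbol_add_one (hg : g.PosDef) :
    ∃ c : ℝ, 0 < c ∧ ∀ k : Fin n → ℤ, c * (1 + ‖k‖) ^ 2 ≤ symbol g k + 1 := by
  obtain ⟨c, hc, h⟩ := exists_le_symbol hg
  refine ⟨min c 1 / 2, by positivity, fun k => ?_⟩
  have h1 : min c 1 * ‖k‖ ^ 2 ≤ c * ‖k‖ ^ 2 := by gcongr; exact min_le_left _ _
  have h2 : min c 1 ≤ 1 := min_le_right _ _
  have h3 : 0 < min c 1 := by positivity
  nlinarith [h k, mul_nonneg h3.le (sq_nonneg (‖k‖ - 1))]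

/-- Smoothing: the norms `‖T(t) U_k‖` decay faster than any power of `k`, uniformly for `t` in a
compact subinterval of `(0, ∞)`. Each application of `IsExpNegSemigroup.norm_apply_le` gains one
power, since the lower order part has order one while the symbol has order two. -/
theorem IsExpNegSemigroup.exists_norm_apply_weyl_le {T : ℝ≥0 → GNS n →L[ℂ] GNS n}
    (hg : g.PosDef) (hT : IsExpNegSemigroup (genLaplacian g lam rho l₁ r₁ l₂ r₂) T) (τ : ℝ)
    (a : ℕ) : ∀ t₀ : ℝ, 0 < t₀ → ∃ Φ : ℝ, 0 ≤ Φ ∧ ∀ t ∈ Set.Icc t₀ τ, ∀ k,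
      ‖T t.toNNReal (weyl k)‖ ≤ Φ * ((1 + ‖k‖) ^ a)⁻¹ := by
  obtain ⟨M, hM⟩ := hT.exists_norm_le τ.toNNReal
  have hM0 : 0 ≤ M := (norm_nonneg _).trans (hM 0 zero_le)
  have hMw : ∀ t ≤ τ, ∀ k, ‖T t.toNNReal (weyl k)‖ ≤ M := fun t ht k => by
    have := (T t.toNNReal).le_of_opNorm_le (hM _ (Real.toNNReal_le_toNNReal ht)) (weyl k)
    rwa [norm_weyl, mul_one] at this
  obtain ⟨c, hc, hcs⟩ := exists_mul_sq_le_symbol_add_one hg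
  induction a with
  | zero => exact fun t₀ _ => ⟨M, hM0, fun t ht k => by simpa using hMw t ht.2 k⟩
  | succ a ih =>
    -- the estimate on `[t₀, τ]` uses the previous one on `[t₀ / 2, τ]`
    intro t₀ ht₀
    obtain ⟨Φ, hΦ, hb⟩ := ih (t₀ / 2) (by positivity)
    obtain ⟨C, hC, hCb⟩ := exists_norm_apply_lowerOrder_le (g := g) (lam := lam) (rho := rho)
      (l₁ := l₁) (r₁ := r₁) (l₂ := l₂) (r₂ := r₂) a
    refine ⟨(a + 1).factorial * ((c * (t₀ / 2)) ^ (a + 1))⁻¹ * M + C * Φ / c, by positivity,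
      fun t ht k => ?_⟩
    have hk : (1 : ℝ) ≤ 1 + ‖k‖ := by linarith [norm_nonneg k]
    have hp : 0 < symbol g k + 1 := lt_of_lt_of_le (by positivity) (hcs k)
    have h1 := hT.norm_apply_le hp (weyl_mem_graph_lowerOrder k) (t₀ := t₀ / 2) (t := t)
      (by positivity) (by linarith [ht.1])
      fun s hs => hCb (T s.toNNReal) Φ hΦ (hb s ⟨hs.1, hs.2.trans ht.2⟩) k
    refine h1.trans ?_
    rw [add_mul _ (C * Φ / c)]
    refine add_le_add ?_ ?_
    · have h2 : c * (t₀ / 2) * (1 + ‖k‖) ≤ (symbol g k + 1) * (t - t₀ / 2) := by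
        calc c * (t₀ / 2) * (1 + ‖k‖) = c * (1 + ‖k‖) * (t₀ / 2) := by ring
          _ ≤ (symbol g k + 1) * (t - t₀ / 2) := by
            refine mul_le_mul (le_trans ?_ (hcs k)) (by linarith [ht.1]) (by positivity) hp.le
            exact mul_le_mul_of_nonneg_left (le_self_pow₀ hk two_ne_zero) hc.le
      have h3 : Real.exp (-((symbol g k + 1) * (t - t₀ / 2))) ≤
          (a + 1).factorial * ((c * (t₀ / 2)) ^ (a + 1))⁻¹ * ((1 + ‖k‖) ^ (a + 1))⁻¹ := by
        have h4 : 0 < c * (t₀ / 2) * (1 + ‖k‖) := by positivity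
        refine (Real.exp_le_exp.2 (neg_le_neg h2)).trans
          ((exp_neg_le_div_pow h4 (a + 1)).trans (le_of_eq ?_))
        rw [mul_pow, mul_inv, mul_assoc]
      calc _ ≤ ((a + 1).factorial * ((c * (t₀ / 2)) ^ (a + 1))⁻¹ * ((1 + ‖k‖) ^ (a + 1))⁻¹) * M :=
            mul_le_mul h3 (hMw (t₀ / 2) (by linarith [ht.1, ht.2]) k) (norm_nonneg _)
              (by positivity)
        _ = _ := by ring
    · rw [div_le_iff₀ hp]
      calc C * Φ * ((1 + ‖k‖) * ((1 + ‖k‖) ^ a)⁻¹)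
          = C * Φ / c * ((1 + ‖k‖) ^ (a + 1))⁻¹ * (c * (1 + ‖k‖) ^ 2) := by
            field_simp
            ring
        _ ≤ _ := by gcongr; exact hcs k

theorem hilbertBasis_weyl_apply (k : Fin n → ℤ) :
    HilbertBasis.ofRepr (LinearIsometryEquiv.refl ℂ (GNS n)) k = weyl k :=
  (HilbertBasis.repr_symm_single _ k).symm

theorem IsExpNegSemigroup.isTraceClass {T : ℝ≥0 → GNS n →L[ℂ] GNS n}
    (hg : g.PosDef) (hT : IsExpNegSemigroup (genLaplacian g lam rho l₁ r₁ l₂ r₂) T) {t : ℝ≥0}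
    (ht : 0 < t) : IsTraceClass (T t) := by
  obtain ⟨a, ha⟩ := exists_summable_weight n
  obtain ⟨Φ, -, hΦ⟩ := hT.exists_norm_apply_weyl_le hg t a t ht
  refine isTraceClass_of_summable_norm (HilbertBasis.ofRepr (LinearIsometryEquiv.refl ℂ (GNS n)))
    (Summable.of_nonneg_of_le (fun k => norm_nonneg _) (fun k => ?_) (ha.mul_left Φ))
  rw [hilbertBasis_weyl_apply]
  simpa using hΦ t ⟨le_rfl, le_rfl⟩ k

end Smoothing

end NCTorus

end

theorem lemma2p1 {n : ℕ} (Θ : Matrix (Fin n) (Fin n) ℝ) (hΘ : Θ.transpose = -Θ)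
    (g : Matrix (Fin n) (Fin n) ℝ) (hg : g.PosDef)
    (lam rho : Fin n → NCTorus.SmoothTorus Θ) (l₁ r₁ l₂ r₂ : NCTorus.SmoothTorus Θ) :
    ∃ T : ℝ≥0 → NCTorus.GNS n →L[ℂ] NCTorus.GNS n,
      NCTorus.IsExpNegSemigroup (NCTorus.genLaplacian g lam rho l₁ r₁ l₂ r₂) T ∧
      (∀ T', NCTorus.IsExpNegSemigroup (NCTorus.genLaplacian g lam rho l₁ r₁ l₂ r₂) T' → T' = T) ∧
      ∀ t : ℝ≥0, 0 < t → NCTorus.IsTraceClass (T t) := by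
  obtain ⟨ω, hω⟩ := NCTorus.exists_genLaplacian_lower_bound (lam := lam) (rho := rho) (l₁ := l₁)
    (r₁ := r₁) (l₂ := l₂) (r₂ := r₂) hg
  obtain ⟨r₀, hr₀⟩ := NCTorus.exists_genLaplacian_surjective (lam := lam) (rho := rho) (l₁ := l₁)
    (r₁ := r₁) (l₂ := l₂) (r₂ := r₂) hg
  have hD := NCTorus.dense_genLaplacian_domain (g := g) (lam := lam) (rho := rho) (l₁ := l₁)
    (r₁ := r₁) (l₂ := l₂) (r₂ := r₂)
  obtain ⟨T, hT⟩ := NCTorus.exists_isExpNegSemigroup hD hω hr₀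
  exact ⟨T, hT, fun T' hT' => hT'.unique hD hω hT, fun t ht => hT.isTraceClass hg ht⟩
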